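/- Let $n = p+q \geq 3$ and let $(M,g)$ be a smooth compact pseudo-Riemannian manifold without boundary, of dimension $n$ and signature $(p,q)$. Fix a Riemannian metric on $M$ with norm $\|\cdot\|$, a bounded measurable frame field $\sigma$ on $M$ (a measurable section of the frame bundle whose image lies in a compact subset of the frame bundle), and a sequence $(T_k)$ of positive numbers with $T_k \to \infty$. For a diffeomorphism $f$ of $M$ let $\mathrm{Jac}_y f = \sigma(f(y))^{-1} \circ D_yf \circ \sigma(y) \in \mathrm{GL}(n,\mathbf{R})$. A sequence $(f_k)$ of diffeomorphisms of $M$ is called uniformly $(T_k)$-Lyapunov regular at $y \in M$ with exponent $\chi \in \mathbf{R}$ if $$\frac{1}{T_k}\log\|D_yf_k v\| \to \chi \ \text{ for all } v \in T_yM\setminus\{0\}, \qquad \frac{1}{T_k}\log|\det \mathrm{Jac}_y f_k| \to n\chi .$$ Let $x \in M$, let $U$ be a connected neighborhood of $x$, and let $(f_k)$ be a sequence of conformal diffeomorphisms of $(M,g)$ (that is, $f_k^*g = \varphi_k g$ for some smooth function $\varphi_k > 0$) such that: 1. every $y \in U$ admits a neighborhood $V$ such that $f_k(\overline{V}) \to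 \{x\}$ for the Hausdorff topology on compact subsets of $M$; 2. there exists $x_0 \in U$ at which $(f_k)$ is uniformly $(T_k)$-Lyapunov regular with exponent $-1$. Then $(f_k)$ is uniformly $(T_k)$-Lyapunov regular with exponent $-1$ at every $y \in U$; in particular $\frac{1}{T_k}\log\|D_yf_kv\| \to -1$ for all $y \in U$ and $v \in T_yM\setminus\{0\}$. -/

import Mathlib

open Filter Topology Bundle TopologicalSpace
open scoped Manifold ContDiff

noncomputable section

namespace ConformalDynamics

/-- A smooth pseudo-Riemannian metric of signature `(p, q)` (`p` minus signs, `q` plus signs) on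
an `n`-dimensional manifold `M`; when `p + q = n` the forms are nondegenerate. -/
structure PseudoRiemannianMetric (n : ℕ) (M : Type*) [TopologicalSpace M]
    [ChartedSpace (EuclideanSpace ℝ (Fin n)) M] [IsManifold (𝓡 n) ∞ M] (p q : ℕ) where
  /-- The symmetric bilinear form on each tangent space. -/
  form (y : M) : TangentSpace (𝓡 n) y →L[ℝ] TangentSpace (𝓡 n) y →L[ℝ] ℝ
  symm (y : M) (u v : TangentSpace (𝓡 n) y) : form y u v = form y v u
  sigNeg_eq (y : M) : sigNeg (form y).toBilinForm.toQuadraticMap = p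
  sigPos_eq (y : M) : sigPos (form y).toBilinForm.toQuadraticMap = q
  contMDiff : ContMDiff (𝓡 n) ((𝓡 n).prod
      𝓘(ℝ, EuclideanSpace ℝ (Fin n) →L[ℝ] EuclideanSpace ℝ (Fin n) →L[ℝ] ℝ)) ∞
    (fun y ↦ TotalSpace.mk' (EuclideanSpace ℝ (Fin n) →L[ℝ] EuclideanSpace ℝ (Fin n) →L[ℝ] ℝ)
      y (form y))

variable {n : ℕ} {M : Type*} [TopologicalSpace M]
  [ChartedSpace (EuclideanSpace ℝ (Fin n)) M] [IsManifold (𝓡 n) ∞ M]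

/-- A diffeomorphism `f` of `M` is conformal for the metric `g` if `f^* g = φ g` for some smooth
function `φ > 0`. -/
def IsConformal {p q : ℕ} (g : PseudoRiemannianMetric n M p q) (f : M ≃ₘ⟮𝓡 n, 𝓡 n⟯ M) : Prop :=
  ∃ φ : M → ℝ, ContMDiff (𝓡 n) 𝓘(ℝ, ℝ) ∞ φ ∧ (∀ y, 0 < φ y) ∧
    ∀ (y : M) (u v : TangentSpace (𝓡 n) y),
      g.form (f y) (mfderiv (𝓡 n) (𝓡 n) f y u) (mfderiv (𝓡 n) (𝓡 n) f y v) =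
        φ y * g.form y u v

/-- The norm on tangent vectors given by a Riemannian metric `h`. -/
def riemannianNorm
    (h : ContMDiffRiemannianMetric (𝓡 n) ∞ (EuclideanSpace ℝ (Fin n))
      (fun y : M ↦ TangentSpace (𝓡 n) y))
    (y : M) (v : TangentSpace (𝓡 n) y) : ℝ :=
  √(h.inner y v v)

variable (n M) in
/-- The total space of the bundle `Hom(ℝⁿ, TM)` over `M`, with its bundle topology. The frame
bundle of `M` is its open subset of linear isomorphisms. -/
abbrev HomFrames : Type _ :=
  TotalSpace (EuclideanSpace ℝ (Fin n) →L[ℝ] EuclideanSpace ℝ (Fin n))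
    (fun y : M ↦ Bundle.Trivial M (EuclideanSpace ℝ (Fin n)) y →L[ℝ] TangentSpace (𝓡 n) y)

variable (n M) in
/-- A bounded measurable frame field on `M`: a Borel section `σ` of the frame bundle whose image
is contained in a compact subset of the frame bundle. -/
structure BoundedFrameField where
  /-- The frame `ℝⁿ ≃ T_y M` at each point. -/
  frame (y : M) : EuclideanSpace ℝ (Fin n) ≃L[ℝ] TangentSpace (𝓡 n) y
  measurable : @Measurable M (HomFrames n M) (borel M) (borel (HomFrames n M))
    (fun y ↦ ⟨y, (frame y : EuclideanSpace ℝ (Fin n) →L[ℝ] TangentSpace (𝓡 n) y)⟩)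
  bounded : ∃ K : Set (HomFrames n M), IsCompact K ∧
    (∀ u ∈ K, Function.Bijective u.2) ∧
    ∀ y, (⟨y, (frame y : EuclideanSpace ℝ (Fin n) →L[ℝ] TangentSpace (𝓡 n) y)⟩ :
      HomFrames n M) ∈ K

/-- The Jacobian `σ(f(y))⁻¹ ∘ D_y f ∘ σ(y)` of `f` at `y` with respect to the frame field `σ`. -/
def jacobian (σ : BoundedFrameField n M) (f : M ≃ₘ⟮𝓡 n, 𝓡 n⟯ M) (y : M) :
    EuclideanSpace ℝ (Fin n) →L[ℝ] EuclideanSpace ℝ (Fin n) :=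
  ((σ.frame (f y)).symm : TangentSpace (𝓡 n) (f y) →L[ℝ] EuclideanSpace ℝ (Fin n)) ∘L
    (mfderiv (𝓡 n) (𝓡 n) f y ∘L
      (σ.frame y : EuclideanSpace ℝ (Fin n) →L[ℝ] TangentSpace (𝓡 n) y))

/-- The sequence `(f_k)` is uniformly `(T_k)`-Lyapunov regular at `y` with exponent `χ`, norms
being taken for the Riemannian metric `h` and Jacobians in the frame field `σ`. -/
structure IsUniformlyLyapunovRegularAt
    (h : ContMDiffRiemannianMetric (𝓡 n) ∞ (EuclideanSpace ℝ (Fin n))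
      (fun y : M ↦ TangentSpace (𝓡 n) y))
    (σ : BoundedFrameField n M) (T : ℕ → ℝ) (f : ℕ → M ≃ₘ⟮𝓡 n, 𝓡 n⟯ M) (χ : ℝ) (y : M) :
    Prop where
  tendsto_norm (v : TangentSpace (𝓡 n) y) (hv : v ≠ 0) :
    Tendsto (fun k ↦ 1 / T k *
      Real.log (riemannianNorm h (f k y) (mfderiv (𝓡 n) (𝓡 n) (f k) y v))) atTop (𝓝 χ)
  tendsto_det :
    Tendsto (fun k ↦ 1 / T k * Real.log |(jacobian σ (f k) y).det|) atTop (𝓝 (n * χ))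

/-- The sets `f_k(closure V)` converge to `{x}` for the Hausdorff topology on the compact subsets
of the compact space `M`. Mathlib's topology on `Compacts M` is the one induced by the Hausdorff
distance of any metric defining the topology of `M`. -/
def CollapsesTo [CompactSpace M] (f : ℕ → M ≃ₘ⟮𝓡 n, 𝓡 n⟯ M) (V : Set M) (x : M) : Prop :=
  Tendsto (fun k ↦ Compacts.map (f k) (f k).continuous ⟨closure V, isClosed_closure.isCompact⟩)
    atTop (𝓝 ({x} : Compacts M))

end ConformalDynamics

end

open Filter Topology Bundle TopologicalSpace
open scoped Manifold ContDiff

set_option maxSynthPendingDepth 3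
set_option synthInstance.maxHeartbeats 200000

noncomputable section

/-! Read in charts, each `f_k` is a map `f` with `f^*G' = e^{2ρ} G` for two fixed pseudo-Riemannian
metrics on open subsets of `ℝⁿ`. The heart of the proof is a Harnack inequality,
`exists_harnack_bounds`: once `f` sends a ball into a small enough ball, on the concentric half ball
`ρ` varies by at most `A` and `‖Df‖` by at most a factor `A`, where `A` depends on the metrics and
the balls but not on `k`.

Such maps satisfy a closed second order system. `D²f` is determined by `Df` and `η = dρ`
(`fderiv_fderiv_apply`). Comparing Ricci curvatures, which determines the Hessian because `n ≥ 3`,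
gives `D²ρ = η ⊗ η - |η|² G / 2 + O(1 + ‖η‖ + ‖Df‖²)` (`norm_hessian_sub_le`). To bound the jet `‖η‖
+ ‖Df‖` (`exists_bound_of_small_oscillation`), suppose that it is huge, and rescale by its value `λ`
at a point where it is nearly maximal. The small oscillation of `f` makes `Df` negligible there, so
up to a small error `η` solves the flat equation, for which `e^{-ρ}` is a quadratic polynomial along
lines. On some line this polynomial becomes nonpositive in bounded time, whereas the bound on `η`
keeps `e^{-ρ}` away from zero (`rescaled_contradiction`). Integrating `η`, and Grönwall's inequality
for `Df`, then give the Harnack inequality.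

Harnack transports regularity. Since `|det Df|` is comparable to `e^{nρ}`, the determinant condition
says that `ρ_k / T_k → χ`; the condition on vectors gives `‖Df_k‖` the rate `χ`. Both rates pass to
nearby points, and there the inequality `e^{2ρ} ‖v‖ ≤ A ‖Df‖ ‖Df v‖` forces each vector to have rate
at least `2χ - χ = χ` (`hasRate_norm_apply`). Regularity is therefore locally constant on the
connected set `U`. -/

namespace ConformalDynamics

/-! ### Algebra of the conformal change of Ricci curvature. -/

section LinearAlgebra

variable {E : Type*} [NormedAddCommGroup E] [NormedSpace ℝ E]

/-- The difference `η(u) v + η(v) u - G(u, v) η^♯` between the Levi-Civita connections of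
`e^{2ρ} G` and `G`, where `η = dρ` and `S` is the musical isomorphism `♯` of `G`. -/
def weylTensor (G : E →L[ℝ] E →L[ℝ] ℝ) (S : (E →L[ℝ] ℝ) →L[ℝ] E) :
    (E →L[ℝ] ℝ) →L[ℝ] E →L[ℝ] E →L[ℝ] E :=
  let D := (ContinuousLinearMap.smulRightL ℝ E (E →L[ℝ] E)).flip (ContinuousLinearMap.id ℝ E)
  D + (ContinuousLinearMap.flipₗᵢ ℝ E E E : (E →L[ℝ] E →L[ℝ] E) →L[ℝ] (E →L[ℝ] E →L[ℝ] E)) ∘L D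
    - ((ContinuousLinearMap.compL ℝ E (E →L[ℝ] ℝ) (E →L[ℝ] E)).flip G) ∘L
        ((ContinuousLinearMap.smulRightL ℝ E E).flip ∘L S)

lemma weylTensor_apply (G : E →L[ℝ] E →L[ℝ] ℝ) (S : (E →L[ℝ] ℝ) →L[ℝ] E) (η : E →L[ℝ] ℝ)
    (u v : E) : weylTensor G S η u v = η u • v + η v • u - G u v • S η := by
  simp [weylTensor]

/-- For a connection form `Γ` with derivative `Γ₁`, the endomorphism `v ↦ R(v, u) w`, where `R`
is the curvature. -/
def curvatureEnd (Γ : E →L[ℝ] E →L[ℝ] E) (Γ₁ : E →L[ℝ] E →L[ℝ] E →L[ℝ] E) (u w : E) :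
    E →L[ℝ] E :=
  (Γ₁.flip u).flip w - (Γ₁ u).flip w + Γ.flip (Γ u w) - (Γ u) ∘L (Γ.flip w)

lemma curvatureEnd_apply (Γ : E →L[ℝ] E →L[ℝ] E) (Γ₁ : E →L[ℝ] E →L[ℝ] E →L[ℝ] E)
    (u w v : E) : curvatureEnd Γ Γ₁ u w v =
      Γ₁ v u w - Γ₁ u v w + Γ v (Γ u w) - Γ u (Γ v w) := by
  simp [curvatureEnd]

lemma norm_apply₂_le {F₁ F₂ F₃ : Type*} [NormedAddCommGroup F₁] [NormedSpace ℝ F₁]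
    [NormedAddCommGroup F₂] [NormedSpace ℝ F₂] [NormedAddCommGroup F₃] [NormedSpace ℝ F₃]
    (B : F₁ →L[ℝ] F₂ →L[ℝ] F₃) (u : F₁) (v : F₂) : ‖B u v‖ ≤ ‖B‖ * ‖u‖ * ‖v‖ :=
  B.le_opNorm₂ u v

lemma norm_apply₃_le {F₁ F₂ F₃ F₄ : Type*} [NormedAddCommGroup F₁] [NormedSpace ℝ F₁]
    [NormedAddCommGroup F₂] [NormedSpace ℝ F₂] [NormedAddCommGroup F₃] [NormedSpace ℝ F₃]
    [NormedAddCommGroup F₄] [NormedSpace ℝ F₄]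
    (B : F₁ →L[ℝ] F₂ →L[ℝ] F₃ →L[ℝ] F₄) (u : F₁) (v : F₂) (w : F₃) :
    ‖B u v w‖ ≤ ‖B‖ * ‖u‖ * ‖v‖ * ‖w‖ :=
  (B u v).le_of_opNorm_le (B.le_opNorm₂ u v) w

lemma norm_curvatureEnd_le (Γ : E →L[ℝ] E →L[ℝ] E) (Γ₁ : E →L[ℝ] E →L[ℝ] E →L[ℝ] E)
    (u w : E) : ‖curvatureEnd Γ Γ₁ u w‖ ≤ 2 * (‖Γ₁‖ + ‖Γ‖ ^ 2) * ‖u‖ * ‖w‖ := by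
  refine ContinuousLinearMap.opNorm_le_bound _ (by positivity) fun v ↦ ?_
  rw [curvatureEnd_apply]
  have h1 := norm_apply₃_le Γ₁ v u w
  have h2 := norm_apply₃_le Γ₁ u v w
  have h3 : ‖Γ v (Γ u w)‖ ≤ ‖Γ‖ * ‖v‖ * (‖Γ‖ * ‖u‖ * ‖w‖) :=
    (norm_apply₂_le Γ v _).trans (by gcongr; exact norm_apply₂_le Γ u w)
  have h4 : ‖Γ u (Γ v w)‖ ≤ ‖Γ‖ * ‖u‖ * (‖Γ‖ * ‖v‖ * ‖w‖) :=
    (norm_apply₂_le Γ u _).trans (by gcongr; exact norm_apply₂_le Γ v w)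
  calc _ ≤ ‖Γ₁ v u w‖ + ‖Γ₁ u v w‖ + ‖Γ v (Γ u w)‖ + ‖Γ u (Γ v w)‖ :=
        (norm_sub_le _ _).trans (add_le_add_left ((norm_add_le _ _).trans
          (add_le_add_left (norm_sub_le _ _) _)) _)
    _ ≤ _ := by linarith

/-- These are the mixed terms in the curvature of `Γ + A`. Being linear in `A`, they contribute an
error linear in `η`, of lower order than the quadratic terms of the flat equation. -/
lemma norm_curvature_cross_le (Γ A : E →L[ℝ] E →L[ℝ] E) (u w : E) :
    ‖Γ.flip (A u w) + A.flip (Γ u w) - (Γ u) ∘L (A.flip w) - (A u) ∘L (Γ.flip w)‖ ≤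
      4 * ‖Γ‖ * ‖A‖ * ‖u‖ * ‖w‖ := by
  refine ContinuousLinearMap.opNorm_le_bound _ (by positivity) fun v ↦ ?_
  have key : ∀ (P Q : E →L[ℝ] E →L[ℝ] E) (a b c : E),
      ‖P a (Q b c)‖ ≤ ‖P‖ * ‖a‖ * (‖Q‖ * ‖b‖ * ‖c‖) := fun P Q a b c ↦
    (norm_apply₂_le P a _).trans (by gcongr; exact norm_apply₂_le Q b c)
  have h1 := key Γ A v u w
  have h2 := key A Γ v u w
  have h3 := key Γ A u v w
  have h4 := key A Γ u v w
  calc _ = ‖Γ v (A u w) + A v (Γ u w) - Γ u (A v w) - A u (Γ v w)‖ := by simp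
    _ ≤ ‖Γ v (A u w)‖ + ‖A v (Γ u w)‖ + ‖Γ u (A v w)‖ + ‖A u (Γ v w)‖ :=
        (norm_sub_le _ _).trans (add_le_add_left ((norm_sub_le _ _).trans
          (add_le_add_left (norm_add_le _ _) _)) _)
    _ ≤ _ := by linarith

variable [FiniteDimensional ℝ E]

variable (E) in
/-- The trace, as a continuous linear form on endomorphisms. -/
def endTrace : (E →L[ℝ] E) →L[ℝ] ℝ :=
  LinearMap.toContinuousLinearMap (LinearMap.trace ℝ E ∘ₗ ContinuousLinearMap.coeLM ℝ)

lemma endTrace_apply (T : E →L[ℝ] E) : endTrace E T = LinearMap.trace ℝ E (T : E →ₗ[ℝ] E) := rfl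

lemma endTrace_smulRight (l : E →L[ℝ] ℝ) (x : E) : endTrace E (l.smulRight x) = l x :=
  LinearMap.trace_smulRight (l : E →ₗ[ℝ] ℝ) x

lemma endTrace_id : endTrace E (ContinuousLinearMap.id ℝ E) = Module.finrank ℝ E :=
  LinearMap.trace_id ℝ E

/-- Conjugate endomorphisms have equal traces. No bound on `F⁻¹` enters, which is essential because
`F` will be the derivative of a collapsing map. -/
lemma endTrace_eq_of_intertwine (F : E ≃L[ℝ] E) {A B : E →L[ℝ] E}
    (h : ∀ v, F (A v) = B (F v)) : endTrace E A = endTrace E B := by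
  rw [endTrace_apply, endTrace_apply, ← LinearMap.trace_conj' _ F.toLinearEquiv]
  congr 1
  ext v
  simp [LinearEquiv.conj_apply, h]

/-- The identity contributes `n η(u)`, and the two rank one terms cancel. -/
lemma endTrace_weylTensor {G : E →L[ℝ] E →L[ℝ] ℝ} {S : (E →L[ℝ] ℝ) →L[ℝ] E}
    (hG : ∀ u v, G u v = G v u) (hS : ∀ l v, G (S l) v = l v) (η : E →L[ℝ] ℝ) (u : E) :
    endTrace E (weylTensor G S η u) = Module.finrank ℝ E * η u := by
  have : weylTensor G S η u = η u • ContinuousLinearMap.id ℝ E + η.smulRight u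
      - (G u).smulRight (S η) := by
    ext v; simp [weylTensor_apply]
  rw [this]
  simp only [map_add, map_sub, map_smul, endTrace_smulRight, endTrace_id, smul_eq_mul]
  rw [hG, hS]; ring

/-- The Ricci contraction of the curvature of the difference tensor of a conformal change. -/
lemma endTrace_curvatureEnd_weylTensor {G : E →L[ℝ] E →L[ℝ] ℝ} {S : (E →L[ℝ] ℝ) →L[ℝ] E}
    (hG : ∀ u v, G u v = G v u) (hS : ∀ l v, G (S l) v = l v) (η : E →L[ℝ] ℝ)
    {H : E →L[ℝ] E →L[ℝ] ℝ} (hH : ∀ u v, H u v = H v u) (u w : E) :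
    endTrace E (curvatureEnd (weylTensor G S η) (weylTensor G S ∘L H) u w) =
      (2 - Module.finrank ℝ E) * H u w - endTrace E (S ∘L H) * G u w +
        (Module.finrank ℝ E - 2) * (η u * η w - η (S η) * G u w) := by
  set A := weylTensor G S η with hA
  -- As endomorphisms of the contracted variable, all terms are multiples of rank one maps, of the
  -- identity, of `S ∘L H` or of `A u`, whose traces are known.
  have : curvatureEnd A (weylTensor G S ∘L H) u w =
      ((H u).smulRight w + (H w).smulRight u - G u w • (S ∘L H))
      - ((H u).smulRight w + H u w • ContinuousLinearMap.id ℝ E - (G w).smulRight (S (H u)))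
      + (η.smulRight (A u w) + η (A u w) • ContinuousLinearMap.id ℝ E
          - (G (A u w)).smulRight (S η))
      - (η.smulRight (A u w) + η w • A u - (G w).smulRight (A u (S η))) := by
    ext v
    rw [curvatureEnd_apply]
    have h1 : A v (A u w) = η v • A u w + η (A u w) • v - G (A u w) v • S η := by
      rw [hA, weylTensor_apply, ← hA, hG v]
    have h2 : A u (A v w) = η v • A u w + η w • A u v - G w v • A u (S η) := by
      rw [hA, weylTensor_apply G S η v w, ← hA, hG v w]; simp
    rw [h1, h2]
    simp only [ContinuousLinearMap.comp_apply, weylTensor_apply]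
    rw [hG v w, hH v u, hH v w]
    simp
  rw [this]
  simp only [map_add, map_sub, map_smul, endTrace_smulRight, endTrace_id, smul_eq_mul]
  rw [endTrace_weylTensor hG hS, hG w, hS, hG w (A u (S η)), hG (A u w), hG (S η)]
  have h3 : A u (S η) = η (S η) • u := by
    rw [hA, weylTensor_apply, hG u, hS]; simp
  have h4 : η (A u w) = 2 * (η u * η w) - η (S η) * G u w := by
    rw [hA, weylTensor_apply]; simp; ring
  rw [hG (A u w) (S η), hS, h4, h3, hH w u]
  simp
  ring

/-- Solving the Ricci contraction for the Hessian. -/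
lemma norm_hessian_sub_le_of_trace {G : E →L[ℝ] E →L[ℝ] ℝ} {S : (E →L[ℝ] ℝ) →L[ℝ] E}
    (hn : 3 ≤ Module.finrank ℝ E)
    (hG : ∀ u v, G u v = G v u) (hS : ∀ l v, G (S l) v = l v) (hS' : ∀ u, S (G u) = u)
    (η : E →L[ℝ] ℝ) {H : E →L[ℝ] E →L[ℝ] ℝ} (hH : ∀ u v, H u v = H v u) {D : ℝ} (hD : 0 ≤ D)
    (hbound : ∀ u w,
      |endTrace E (curvatureEnd (weylTensor G S η) (weylTensor G S ∘L H) u w)| ≤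
        D * ‖u‖ * ‖w‖) :
    ‖H - (η.smulRight η - (η (S η) / 2) • G)‖ ≤ (1 + ‖endTrace E‖ * ‖S‖ * ‖G‖) * D := by
  set X := H - (η.smulRight η - (η (S η) / 2) • G) with hX
  set n : ℝ := (Module.finrank ℝ E : ℝ) with hndef
  have hn' : (3 : ℝ) ≤ n := by rw [hndef]; exact_mod_cast hn
  have hSG : S ∘L G = ContinuousLinearMap.id ℝ E := by ext u; simp [hS']
  have hσ : endTrace E (S ∘L X) =
      endTrace E (S ∘L H) - η (S η) + n / 2 * η (S η) := by
    have : S ∘L X = S ∘L H - η.smulRight (S η) + (η (S η) / 2) • (S ∘L G) := by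
      ext v; simp [hX]; abel
    rw [this, hSG]
    simp only [map_add, map_sub, map_smul, endTrace_smulRight, endTrace_id, smul_eq_mul]
    ring
  -- The contraction vanishes on the flat model, so it depends only on the deviation `X`, linearly.
  -- It is inverted by first taking its trace, where the coefficient is `2 - 2n`, and then dividing
  -- by `n - 2`, which is at least `1` as `n ≥ 3`.
  set ε : E →L[ℝ] E →L[ℝ] ℝ := (2 - n) • X - endTrace E (S ∘L X) • G with hε
  have hεuw : ∀ u w, ε u w =
      endTrace E (curvatureEnd (weylTensor G S η) (weylTensor G S ∘L H) u w) := by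
    intro u w
    rw [endTrace_curvatureEnd_weylTensor hG hS η hH, hε, hσ, hX]
    simp
    ring
  have hεn : ‖ε‖ ≤ D := ContinuousLinearMap.opNorm_le_bound₂ _ hD fun u w ↦ by
    rw [hεuw]; exact hbound u w
  have htr : endTrace E (S ∘L ε) = (2 - 2 * n) * endTrace E (S ∘L X) := by
    have : S ∘L ε = (2 - n) • (S ∘L X) - endTrace E (S ∘L X) • (S ∘L G) := by
      ext v; simp [hε]
    rw [this, hSG]
    simp only [map_sub, map_smul, endTrace_id, smul_eq_mul]
    ring
  have hσb : |endTrace E (S ∘L X)| ≤ ‖endTrace E‖ * ‖S‖ * D := by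
    have h1 : |endTrace E (S ∘L ε)| ≤ ‖endTrace E‖ * (‖S‖ * D) :=
      ((endTrace E).le_opNorm _).trans (by
        gcongr; exact (ContinuousLinearMap.opNorm_comp_le _ _).trans (by gcongr))
    rw [htr, abs_mul, abs_of_nonpos (by linarith : 2 - 2 * n ≤ 0)] at h1
    nlinarith [abs_nonneg (endTrace E (S ∘L X))]
  have hXε : (n - 2) • X = -(ε + endTrace E (S ∘L X) • G) := by
    rw [hε]; module
  have h2 : (n - 2) * ‖X‖ ≤ D + ‖endTrace E‖ * ‖S‖ * D * ‖G‖ := by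
    have := congrArg norm hXε
    rw [norm_smul, norm_neg, Real.norm_of_nonneg (by linarith)] at this
    rw [this]
    refine (norm_add_le _ _).trans (add_le_add hεn ?_)
    rw [norm_smul]
    exact mul_le_mul_of_nonneg_right hσb (norm_nonneg _)
  nlinarith [norm_nonneg X]

/-- If an isomorphism `F` intertwines the curvature of `Γ + weylTensor G S η` with the curvature
of `Γ'`, then the derivative `H` of `η` agrees with that of a flat conformal factor up to
lower order terms. -/
lemma norm_hessian_sub_le_of_curvature {G : E →L[ℝ] E →L[ℝ] ℝ} {S : (E →L[ℝ] ℝ) →L[ℝ] E}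
    (hn : 3 ≤ Module.finrank ℝ E)
    (hG : ∀ u v, G u v = G v u) (hS : ∀ l v, G (S l) v = l v) (hS' : ∀ u, S (G u) = u)
    (η : E →L[ℝ] ℝ) {H : E →L[ℝ] E →L[ℝ] ℝ} (hH : ∀ u v, H u v = H v u)
    {Γ Γ' : E →L[ℝ] E →L[ℝ] E} {Γ₁ Γ₁' : E →L[ℝ] E →L[ℝ] E →L[ℝ] E}
    {W₁ : E →L[ℝ] (E →L[ℝ] ℝ) →L[ℝ] E →L[ℝ] E →L[ℝ] E} (F : E ≃L[ℝ] E) {C : ℝ}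
    (hΓ : ‖Γ‖ ≤ C) (hΓ₁ : ‖Γ₁‖ ≤ C) (hΓ' : ‖Γ'‖ ≤ C) (hΓ₁' : ‖Γ₁'‖ ≤ C) (hW₁ : ‖W₁‖ ≤ C)
    (hW : ‖weylTensor G S‖ ≤ C) (hSC : ‖S‖ ≤ C) (hGC : ‖G‖ ≤ C)
    (hF : ∀ u v w, F (curvatureEnd (Γ + weylTensor G S η)
        (Γ₁ + W₁.flip η + weylTensor G S ∘L H) u w v) =
      curvatureEnd Γ' Γ₁' (F u) (F w) (F v)) :
    ‖H - (η.smulRight η - (η (S η) / 2) • G)‖ ≤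
      (1 + ‖endTrace E‖ * C * C) * (‖endTrace E‖ * (4 * (C + C ^ 2)) *
        (1 + ‖η‖ + ‖(F : E →L[ℝ] E)‖ ^ 2)) := by
  have hC : 0 ≤ C := (norm_nonneg _).trans hΓ
  set A := weylTensor G S η with hA
  have hAn : ‖A‖ ≤ C * ‖η‖ := ((weylTensor G S).le_opNorm η).trans (by gcongr)
  have hW₁n : ‖W₁.flip η‖ ≤ C * ‖η‖ :=
    (W₁.flip.le_opNorm η).trans (by rw [ContinuousLinearMap.opNorm_flip]; gcongr)
  refine (norm_hessian_sub_le_of_trace hn hG hS hS' η hH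
    (D := ‖endTrace E‖ * (4 * (C + C ^ 2)) * (1 + ‖η‖ + ‖(F : E →L[ℝ] E)‖ ^ 2))
    (by positivity) fun u w ↦ ?_).trans (by gcongr)
  have htrace := endTrace_eq_of_intertwine F (fun v ↦ hF u v w)
  -- All terms quadratic in `η` belong to the curvature of `A` alone, which is treated exactly; what
  -- remains is at most linear in `η`.
  have hsplit : curvatureEnd A (weylTensor G S ∘L H) u w =
      curvatureEnd (Γ + A) (Γ₁ + W₁.flip η + weylTensor G S ∘L H) u w
      - (curvatureEnd Γ (Γ₁ + W₁.flip η) u w +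
        (Γ.flip (A u w) + A.flip (Γ u w) - (Γ u) ∘L (A.flip w) - (A u) ∘L (Γ.flip w))) := by
    ext v
    simp [curvatureEnd_apply]
    abel
  rw [hsplit, map_sub, htrace, ← map_sub]
  have hFu : ‖F u‖ ≤ ‖(F : E →L[ℝ] E)‖ * ‖u‖ := (F : E →L[ℝ] E).le_opNorm u
  have hFw : ‖F w‖ ≤ ‖(F : E →L[ℝ] E)‖ * ‖w‖ := (F : E →L[ℝ] E).le_opNorm w
  have hE0 : ‖Γ₁ + W₁.flip η‖ ≤ C + C * ‖η‖ := (norm_add_le _ _).trans (by gcongr)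
  have hE1 : ‖curvatureEnd Γ' Γ₁' (F u) (F w)‖ ≤
      2 * (C + C ^ 2) * (‖(F : E →L[ℝ] E)‖ * ‖u‖) * (‖(F : E →L[ℝ] E)‖ * ‖w‖) :=
    (norm_curvatureEnd_le _ _ _ _).trans (by gcongr)
  have hE2 : ‖curvatureEnd Γ (Γ₁ + W₁.flip η) u w‖ ≤
      2 * (C + C * ‖η‖ + C ^ 2) * ‖u‖ * ‖w‖ :=
    (norm_curvatureEnd_le _ _ _ _).trans (by gcongr)
  have hE3 : ‖Γ.flip (A u w) + A.flip (Γ u w) - (Γ u) ∘L (A.flip w) - (A u) ∘L (Γ.flip w)‖ ≤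
      4 * C * (C * ‖η‖) * ‖u‖ * ‖w‖ :=
    (norm_curvature_cross_le _ _ _ _).trans (by gcongr)
  refine ((endTrace E).le_opNorm _).trans ?_
  rw [mul_assoc, mul_assoc, mul_assoc]
  refine mul_le_mul_of_nonneg_left ?_ (norm_nonneg _)
  refine (norm_sub_le _ _).trans ((add_le_add hE1 ((norm_add_le _ _).trans
    (add_le_add hE2 hE3))).trans ?_)
  have h0 : 0 ≤ ‖u‖ * ‖w‖ := by positivity
  have h1 : 0 ≤ C * (‖u‖ * ‖w‖) := by positivity
  have h2 : 0 ≤ C ^ 2 * (‖u‖ * ‖w‖) := by positivity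
  have h3 : 0 ≤ C * (‖u‖ * ‖w‖) * ‖η‖ := by positivity
  have h4 : 0 ≤ C ^ 2 * (‖u‖ * ‖w‖) * ‖η‖ := by positivity
  have h5 : 0 ≤ C * (‖u‖ * ‖w‖) * ‖(F : E →L[ℝ] E)‖ ^ 2 := by positivity
  have h6 : 0 ≤ C ^ 2 * (‖u‖ * ‖w‖) * ‖(F : E →L[ℝ] E)‖ ^ 2 := by positivity
  nlinarith

end LinearAlgebra

/-! ### The second order system satisfied by a conformal map and its factor. -/

section Calculus

variable {E : Type*} [NormedAddCommGroup E] [NormedSpace ℝ E]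

lemma two_le_infty : (2 : WithTop ℕ∞) ≤ ∞ :=
  WithTop.coe_le_coe.2 (le_top : (2 : ℕ∞) ≤ ⊤)

/-- A smooth field of nondegenerate symmetric bilinear forms on an open subset of a vector
space. -/
structure IsMetricOn (G : E → E →L[ℝ] E →L[ℝ] ℝ) (Ω : Set E) : Prop where
  isOpen : IsOpen Ω
  contDiffOn : ContDiffOn ℝ ∞ G Ω
  symm : ∀ y ∈ Ω, ∀ u v, G y u v = G y v u
  isInvertible : ∀ y ∈ Ω, (G y).IsInvertible

/-- The map `f` is conformal from `(Ω, G)` to `(Ω', G')`, with conformal factor `e^{2ρ}`. -/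
structure IsConformalOn (G G' : E → E →L[ℝ] E →L[ℝ] ℝ) (Ω Ω' : Set E) (f : E → E) (ρ : E → ℝ) :
    Prop where
  source : IsMetricOn G Ω
  target : IsMetricOn G' Ω'
  contDiffOn : ContDiffOn ℝ ∞ f Ω
  mapsTo : Set.MapsTo f Ω Ω'
  contDiffOn_factor : ContDiffOn ℝ ∞ ρ Ω
  conformal : ∀ y ∈ Ω, ∀ u v,
    G' (f y) (fderiv ℝ f y u) (fderiv ℝ f y v) = Real.exp (2 * ρ y) * G y u v

/-- The derivative `B` of a metric, turned into the Christoffel symbols of the first kind. -/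
def koszul : (E →L[ℝ] E →L[ℝ] E →L[ℝ] ℝ) →L[ℝ] (E →L[ℝ] E →L[ℝ] E →L[ℝ] ℝ) :=
  let φ : (E →L[ℝ] E →L[ℝ] E →L[ℝ] ℝ) →L[ℝ] (E →L[ℝ] E →L[ℝ] E →L[ℝ] ℝ) :=
    ContinuousLinearMap.flipₗᵢ ℝ E E (E →L[ℝ] ℝ)
  let ψ : (E →L[ℝ] E →L[ℝ] ℝ) →L[ℝ] (E →L[ℝ] E →L[ℝ] ℝ) := ContinuousLinearMap.flipₗᵢ ℝ E E ℝ
  (1 / 2 : ℝ) • (ContinuousLinearMap.id ℝ _ + φ -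
    (ContinuousLinearMap.compL ℝ E (E →L[ℝ] E →L[ℝ] ℝ) (E →L[ℝ] E →L[ℝ] ℝ) ψ) ∘L φ)

lemma koszul_apply (B : E →L[ℝ] E →L[ℝ] E →L[ℝ] ℝ) (u v w : E) :
    koszul B u v w = (B u v w + B v u w - B w u v) / 2 := by
  have : koszul B u v w = 1 / 2 * (B u v w + B v u w - B w u v) := rfl
  rw [this]
  ring

/-- The Christoffel symbols of a metric field. -/
def christoffel (G : E → E →L[ℝ] E →L[ℝ] ℝ) (y : E) : E →L[ℝ] E →L[ℝ] E :=
  (ContinuousLinearMap.compL ℝ E (E →L[ℝ] ℝ) E (G y).inverse) ∘L koszul (fderiv ℝ G y)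

namespace IsMetricOn

variable {G : E → E →L[ℝ] E →L[ℝ] ℝ} {Ω : Set E} {y : E}

lemma contDiffAt (h : IsMetricOn G Ω) (hy : y ∈ Ω) : ContDiffAt ℝ ∞ G y :=
  h.contDiffOn.contDiffAt (h.isOpen.mem_nhds hy)

lemma apply_christoffel (h : IsMetricOn G Ω) (hy : y ∈ Ω) (u v w : E) :
    G y (christoffel G y u v) w =
      (fderiv ℝ G y u v w + fderiv ℝ G y v u w - fderiv ℝ G y w u v) / 2 := by
  rw [← koszul_apply]
  simp only [christoffel, ContinuousLinearMap.comp_apply, ContinuousLinearMap.compL_apply]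
  rw [(h.isInvertible y hy).self_apply_inverse]

variable [CompleteSpace E]

lemma contDiffAt_inverse (h : IsMetricOn G Ω) (hy : y ∈ Ω) :
    ContDiffAt ℝ ∞ (fun z ↦ (G z).inverse) y :=
  ((h.isInvertible y hy).contDiffAt_map_inverse).comp y (h.contDiffAt hy)

lemma contDiffAt_christoffel (h : IsMetricOn G Ω) (hy : y ∈ Ω) :
    ContDiffAt ℝ ∞ (christoffel G) y := by
  have h1 : ContDiffAt ℝ ∞ (fderiv ℝ G) y := (h.contDiffAt hy).fderiv_right (by simp)
  exact (((ContinuousLinearMap.compL ℝ E (E →L[ℝ] ℝ) E).contDiff.contDiffAt).comp y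
    (h.contDiffAt_inverse hy)).clm_comp ((koszul (E := E)).contDiff.contDiffAt.comp y h1)

lemma contDiffAt_weylTensor (h : IsMetricOn G Ω) (hy : y ∈ Ω) :
    ContDiffAt ℝ ∞ (fun z ↦ weylTensor (G z) (G z).inverse) y := by
  unfold weylTensor
  refine contDiffAt_const.sub ?_
  refine ContDiffAt.clm_comp ?_ (contDiffAt_const.clm_comp (h.contDiffAt_inverse hy))
  exact ((ContinuousLinearMap.compL ℝ E (E →L[ℝ] ℝ) (E →L[ℝ] E)).flip.contDiff.contDiffAt).comp y
    (h.contDiffAt hy)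

end IsMetricOn

namespace IsConformalOn

variable {G G' : E → E →L[ℝ] E →L[ℝ] ℝ} {Ω Ω' : Set E} {f : E → E} {ρ : E → ℝ} {y : E}

lemma contDiffAt (h : IsConformalOn G G' Ω Ω' f ρ) (hy : y ∈ Ω) : ContDiffAt ℝ ∞ f y :=
  h.contDiffOn.contDiffAt (h.source.isOpen.mem_nhds hy)

lemma contDiffAt_factor (h : IsConformalOn G G' Ω Ω' f ρ) (hy : y ∈ Ω) : ContDiffAt ℝ ∞ ρ y :=
  h.contDiffOn_factor.contDiffAt (h.source.isOpen.mem_nhds hy)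

lemma contDiffAt_fderiv (h : IsConformalOn G G' Ω Ω' f ρ) (hy : y ∈ Ω) :
    ContDiffAt ℝ ∞ (fderiv ℝ f) y :=
  (h.contDiffAt hy).fderiv_right (by simp)

lemma contDiffAt_fderiv_factor (h : IsConformalOn G G' Ω Ω' f ρ) (hy : y ∈ Ω) :
    ContDiffAt ℝ ∞ (fderiv ℝ ρ) y :=
  (h.contDiffAt_factor hy).fderiv_right (by simp)

lemma hasFDerivAt (h : IsConformalOn G G' Ω Ω' f ρ) (hy : y ∈ Ω) :
    HasFDerivAt f (fderiv ℝ f y) y :=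
  ((h.contDiffAt hy).differentiableAt (by simp)).hasFDerivAt

lemma hasFDerivAt_fderiv (h : IsConformalOn G G' Ω Ω' f ρ) (hy : y ∈ Ω) :
    HasFDerivAt (fderiv ℝ f) (fderiv ℝ (fderiv ℝ f) y) y :=
  ((h.contDiffAt_fderiv hy).differentiableAt (by simp)).hasFDerivAt

lemma hasFDerivAt_factor (h : IsConformalOn G G' Ω Ω' f ρ) (hy : y ∈ Ω) :
    HasFDerivAt ρ (fderiv ℝ ρ y) y :=
  ((h.contDiffAt_factor hy).differentiableAt (by simp)).hasFDerivAt

lemma hasFDerivAt_fderiv_factor (h : IsConformalOn G G' Ω Ω' f ρ) (hy : y ∈ Ω) :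
    HasFDerivAt (fderiv ℝ ρ) (fderiv ℝ (fderiv ℝ ρ) y) y :=
  ((h.contDiffAt_fderiv_factor hy).differentiableAt (by simp)).hasFDerivAt

lemma fderiv_fderiv_symm (h : IsConformalOn G G' Ω Ω' f ρ) (hy : y ∈ Ω) (u v : E) :
    fderiv ℝ (fderiv ℝ f) y u v = fderiv ℝ (fderiv ℝ f) y v u :=
  ((h.contDiffAt hy).isSymmSndFDerivAt (by simpa using two_le_infty)) u v

lemma fderiv_fderiv_factor_symm (h : IsConformalOn G G' Ω Ω' f ρ) (hy : y ∈ Ω) (u v : E) :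
    fderiv ℝ (fderiv ℝ ρ) y u v = fderiv ℝ (fderiv ℝ ρ) y v u :=
  ((h.contDiffAt_factor hy).isSymmSndFDerivAt (by simpa using two_le_infty)) u v

/-- A vector killed by the derivative is `G`-orthogonal to everything, hence zero by nondegeneracy.
-/
lemma injective_fderiv (h : IsConformalOn G G' Ω Ω' f ρ) (hy : y ∈ Ω) :
    Function.Injective (fderiv ℝ f y) := by
  rw [injective_iff_map_eq_zero]
  intro u hu
  apply (h.source.isInvertible y hy).injective
  ext v
  have := h.conformal y hy u v
  rw [hu] at this
  simpa using this.symm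

/-- Differentiate the conformality identity, with `u` and `v` held constant, in the direction `w`.
-/
lemma fderiv_metric_comp (h : IsConformalOn G G' Ω Ω' f ρ) (hy : y ∈ Ω) (u v w : E) :
    fderiv ℝ G' (f y) (fderiv ℝ f y w) (fderiv ℝ f y u) (fderiv ℝ f y v) +
      G' (f y) (fderiv ℝ (fderiv ℝ f) y w u) (fderiv ℝ f y v) +
      G' (f y) (fderiv ℝ f y u) (fderiv ℝ (fderiv ℝ f) y w v) =
    Real.exp (2 * ρ y) * (2 * fderiv ℝ ρ y w * G y u v + fderiv ℝ G y w u v) := by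
  have hG' : HasFDerivAt G' (fderiv ℝ G' (f y)) (f y) :=
    ((h.target.contDiffAt (h.mapsTo hy)).differentiableAt (by simp)).hasFDerivAt
  have hG : HasFDerivAt G (fderiv ℝ G y) y :=
    ((h.source.contDiffAt hy).differentiableAt (by simp)).hasFDerivAt
  have hF := h.hasFDerivAt_fderiv hy
  have h1 := ((hG'.comp y (h.hasFDerivAt hy)).clm_apply
    (hF.clm_apply (hasFDerivAt_const u y))).clm_apply (hF.clm_apply (hasFDerivAt_const v y))
  have h2 := (((h.hasFDerivAt_factor hy).const_mul 2).exp).mul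
    ((hG.clm_apply (hasFDerivAt_const u y)).clm_apply (hasFDerivAt_const v y))
  have heq := (h1.congr_of_eventuallyEq (f₁ := fun z ↦ Real.exp (2 * ρ z) * G z u v)
    (by filter_upwards [h.source.isOpen.mem_nhds hy] with z hz
        exact (h.conformal z hz u v).symm)).unique h2
  have := congrArg (fun L ↦ L w) heq
  simp at this
  linarith

variable [FiniteDimensional ℝ E]

lemma surjective_fderiv (h : IsConformalOn G G' Ω Ω' f ρ) (hy : y ∈ Ω) :
    Function.Surjective (fderiv ℝ f y) :=
  LinearMap.injective_iff_surjective.mp (h.injective_fderiv hy)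

/-- The second derivative of a conformal map is determined by its first derivative and the
derivative of the conformal factor. -/
theorem fderiv_fderiv_apply (h : IsConformalOn G G' Ω Ω' f ρ) (hy : y ∈ Ω) (u v : E) :
    fderiv ℝ (fderiv ℝ f) y u v =
      fderiv ℝ f y ((christoffel G y + weylTensor (G y) (G y).inverse (fderiv ℝ ρ y)) u v) -
        christoffel G' (f y) (fderiv ℝ f y u) (fderiv ℝ f y v) := by
  rw [eq_sub_iff_add_eq]
  apply (h.target.isInvertible _ (h.mapsTo hy)).injective
  ext w'
  obtain ⟨w, rfl⟩ := h.surjective_fderiv hy w'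
  rw [h.conformal y hy, map_add, add_apply,
    h.target.apply_christoffel (h.mapsTo hy)]
  -- Koszul's trick: the three cyclic versions of the differentiated identity, combined as `e1 + e2
  -- - e3`, isolate `D²f(u, v)`.
  have e1 := h.fderiv_metric_comp hy v w u
  have e2 := h.fderiv_metric_comp hy u w v
  have e3 := h.fderiv_metric_comp hy u v w
  have hs := h.target.symm _ (h.mapsTo hy)
  rw [h.fderiv_fderiv_symm hy w u, hs (fderiv ℝ f y u) (fderiv ℝ (fderiv ℝ f) y w v),
    h.fderiv_fderiv_symm hy w v] at e3
  rw [h.fderiv_fderiv_symm hy v u, hs (fderiv ℝ f y u)] at e2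
  rw [hs (fderiv ℝ f y v)] at e1
  simp only [add_apply, map_add, h.source.apply_christoffel hy,
    weylTensor_apply, map_sub, map_smul, sub_apply,
    smul_apply, smul_eq_mul, (h.source.isInvertible y hy).self_apply_inverse]
  have e4 := hs (fderiv ℝ (fderiv ℝ f) y u w) (fderiv ℝ f y v)
  linarith

/-- A conformal map intertwines the curvature of the transformed connection with that of the
target. -/
theorem fderiv_curvatureEnd (h : IsConformalOn G G' Ω Ω' f ρ) (hy : y ∈ Ω) (u v w : E) :
    fderiv ℝ f y (curvatureEnd
      (christoffel G y + weylTensor (G y) (G y).inverse (fderiv ℝ ρ y))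
      (fderiv ℝ (christoffel G) y +
        (fderiv ℝ (fun z ↦ weylTensor (G z) (G z).inverse) y).flip (fderiv ℝ ρ y) +
        weylTensor (G y) (G y).inverse ∘L fderiv ℝ (fderiv ℝ ρ) y) u w v) =
    curvatureEnd (christoffel G' (f y)) (fderiv ℝ (christoffel G') (f y))
      (fderiv ℝ f y u) (fderiv ℝ f y w) (fderiv ℝ f y v) := by
  have : CompleteSpace E := FiniteDimensional.complete ℝ E
  have hΓ : HasFDerivAt (christoffel G) (fderiv ℝ (christoffel G) y) y :=
    ((h.source.contDiffAt_christoffel hy).differentiableAt (by simp)).hasFDerivAt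
  have hΓ' : HasFDerivAt (christoffel G') (fderiv ℝ (christoffel G') (f y)) (f y) :=
    ((h.target.contDiffAt_christoffel (h.mapsTo hy)).differentiableAt (by simp)).hasFDerivAt
  have hW : HasFDerivAt (fun z ↦ weylTensor (G z) (G z).inverse)
      (fderiv ℝ (fun z ↦ weylTensor (G z) (G z).inverse) y) y :=
    ((h.source.contDiffAt_weylTensor hy).differentiableAt (by simp)).hasFDerivAt
  have hF := h.hasFDerivAt_fderiv hy
  have hθ := hΓ.add (hW.clm_apply (h.hasFDerivAt_fderiv_factor hy))
  have hF2 : ∀ a b c : E, fderiv ℝ (fderiv ℝ (fderiv ℝ f)) y a b c =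
      fderiv ℝ (fderiv ℝ (fderiv ℝ f)) y b a c := fun a b c ↦
    congrArg (fun L ↦ L c)
      (((h.contDiffAt_fderiv hy).isSymmSndFDerivAt (by simpa using two_le_infty)) a b)
  have hF1 : HasFDerivAt (fderiv ℝ (fderiv ℝ f)) (fderiv ℝ (fderiv ℝ (fderiv ℝ f)) y) y :=
    (((h.contDiffAt_fderiv hy).fderiv_right (m := ∞) (by simp)).differentiableAt
      (by simp)).hasFDerivAt
  set θ₁ := fderiv ℝ (christoffel G) y +
        (fderiv ℝ (fun z ↦ weylTensor (G z) (G z).inverse) y).flip (fderiv ℝ ρ y) +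
        weylTensor (G y) (G y).inverse ∘L fderiv ℝ (fderiv ℝ ρ) y with hθ₁
  set θ := fun z ↦ christoffel G z + weylTensor (G z) (G z).inverse (fderiv ℝ ρ z) with hθdef
  replace hθ : HasFDerivAt θ θ₁ y := by
    convert! hθ using 1
    rw [hθ₁]; abel
  have key : ∀ a b : E, fderiv ℝ (fderiv ℝ (fderiv ℝ f)) y a b w =
      fderiv ℝ (fderiv ℝ f) y a (θ y b w) + fderiv ℝ f y (θ₁ a b w) -
      (fderiv ℝ (christoffel G') (f y) (fderiv ℝ f y a) (fderiv ℝ f y b) (fderiv ℝ f y w) +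
        christoffel G' (f y) (fderiv ℝ (fderiv ℝ f) y a b) (fderiv ℝ f y w) +
        christoffel G' (f y) (fderiv ℝ f y b) (fderiv ℝ (fderiv ℝ f) y a w)) := by
    intro a b
    have h1 := (hF1.clm_apply (hasFDerivAt_const b y)).clm_apply (hasFDerivAt_const w y)
    have h2 := (hF.clm_apply ((hθ.clm_apply (hasFDerivAt_const b y)).clm_apply
      (hasFDerivAt_const w y))).sub
      (((hΓ'.comp y (h.hasFDerivAt hy)).clm_apply
        (hF.clm_apply (hasFDerivAt_const b y))).clm_apply (hF.clm_apply (hasFDerivAt_const w y)))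
    have heq := (h1.congr_of_eventuallyEq (f₁ := _) (by
      filter_upwards [h.source.isOpen.mem_nhds hy] with z hz
      exact (h.fderiv_fderiv_apply hz b w).symm)).unique h2
    have := congrArg (fun L ↦ L a) heq
    simp at this
    rw [this]
    abel
  -- Integrability condition: differentiating `D²f = Df ∘ θ - Γ'(Df, Df)` and using the symmetry of
  -- `D³f` in its first two arguments leaves exactly the two curvatures.
  have hsymm := hF2 v u w
  rw [key, key] at hsymm
  have hθs : ∀ a b, fderiv ℝ (fderiv ℝ f) y a b = fderiv ℝ f y (θ y a b) -
      christoffel G' (f y) (fderiv ℝ f y a) (fderiv ℝ f y b) := fun a b ↦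
    h.fderiv_fderiv_apply hy a b
  rw [h.fderiv_fderiv_symm hy u v] at hsymm
  rw [hθs v (θ y u w), hθs u (θ y v w), hθs v w, hθs u w] at hsymm
  change fderiv ℝ f y (curvatureEnd (θ y) θ₁ u w v) = _
  rw [curvatureEnd_apply, curvatureEnd_apply]
  simp only [map_add, map_sub] at hsymm ⊢
  rw [← sub_eq_zero] at hsymm ⊢
  rw [← hsymm]
  abel

/-- Second order system satisfied by the conformal factor and the derivative of a conformal
map, up to lower order terms, with constants depending only on bounds for the metrics. -/
theorem norm_hessian_sub_le (h : IsConformalOn G G' Ω Ω' f ρ) (hy : y ∈ Ω)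
    (hn : 3 ≤ Module.finrank ℝ E) {C : ℝ}
    (hΓ : ‖christoffel G y‖ ≤ C) (hΓ₁ : ‖fderiv ℝ (christoffel G) y‖ ≤ C)
    (hΓ' : ‖christoffel G' (f y)‖ ≤ C) (hΓ₁' : ‖fderiv ℝ (christoffel G') (f y)‖ ≤ C)
    (hW₁ : ‖fderiv ℝ (fun z ↦ weylTensor (G z) (G z).inverse) y‖ ≤ C)
    (hW : ‖weylTensor (G y) (G y).inverse‖ ≤ C) (hSC : ‖(G y).inverse‖ ≤ C) (hGC : ‖G y‖ ≤ C) :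
    ‖fderiv ℝ (fderiv ℝ ρ) y - ((fderiv ℝ ρ y).smulRight (fderiv ℝ ρ y) -
        (fderiv ℝ ρ y ((G y).inverse (fderiv ℝ ρ y)) / 2) • G y)‖ ≤
      (1 + ‖endTrace E‖ * C * C) * (‖endTrace E‖ * (4 * (C + C ^ 2)) *
        (1 + ‖fderiv ℝ ρ y‖ + ‖fderiv ℝ f y‖ ^ 2)) := by
  let F : E ≃L[ℝ] E := (LinearEquiv.ofBijective (fderiv ℝ f y : E →ₗ[ℝ] E)
    ⟨h.injective_fderiv hy, h.surjective_fderiv hy⟩).toContinuousLinearEquiv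
  have hF : (F : E →L[ℝ] E) = fderiv ℝ f y := by ext; rfl
  rw [← hF]
  have hinv := h.source.isInvertible y hy
  exact norm_hessian_sub_le_of_curvature hn (h.source.symm y hy)
    (fun l v ↦ by rw [hinv.self_apply_inverse]) hinv.inverse_apply_self
    (fderiv ℝ ρ y) (h.fderiv_fderiv_factor_symm hy) F hΓ hΓ₁ hΓ' hΓ₁' hW₁ hW hSC hGC
    (fun u v w ↦ h.fderiv_curvatureEnd hy u v w)

/-- Every term of `D²f` carries a factor `Df`. Once the jet is bounded, this estimate becomes linear
in `Df`, as Grönwall's inequality requires. -/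
theorem norm_fderiv_fderiv_le (h : IsConformalOn G G' Ω Ω' f ρ) (hy : y ∈ Ω) {C : ℝ}
    (hΓ : ‖christoffel G y‖ ≤ C) (hΓ' : ‖christoffel G' (f y)‖ ≤ C)
    (hW : ‖weylTensor (G y) (G y).inverse‖ ≤ C) :
    ‖fderiv ℝ (fderiv ℝ f) y‖ ≤
      C * ‖fderiv ℝ f y‖ * (1 + ‖fderiv ℝ ρ y‖ + ‖fderiv ℝ f y‖) := by
  have hC : 0 ≤ C := (norm_nonneg _).trans hΓ
  set F := fderiv ℝ f y
  set η := fderiv ℝ ρ y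
  refine ContinuousLinearMap.opNorm_le_bound₂ _ (by positivity) fun u v ↦ ?_
  rw [h.fderiv_fderiv_apply hy]
  have h1 : ‖christoffel G y + weylTensor (G y) (G y).inverse η‖ ≤ C + C * ‖η‖ :=
    (norm_add_le _ _).trans (add_le_add hΓ (((weylTensor (G y) (G y).inverse).le_opNorm η).trans
      (by gcongr)))
  have h2 : ‖F ((christoffel G y + weylTensor (G y) (G y).inverse η) u v)‖ ≤
      ‖F‖ * ((C + C * ‖η‖) * ‖u‖ * ‖v‖) :=
    (F.le_opNorm _).trans (by gcongr; exact (norm_apply₂_le _ u v).trans (by gcongr))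
  have h3 : ‖christoffel G' (f y) (F u) (F v)‖ ≤ C * (‖F‖ * ‖u‖) * (‖F‖ * ‖v‖) :=
    (norm_apply₂_le _ _ _).trans (by gcongr <;> exact F.le_opNorm _)
  refine (norm_sub_le _ _).trans ((add_le_add h2 h3).trans (le_of_eq ?_))
  ring

end IsConformalOn

end Calculus

/-! ### Bound on the jet by rescaling and contradiction. -/

section Rescaling

/-- Along a line, the inverse square root of the conformal factor is nearly a quadratic
polynomial. -/
lemma inverse_factor_le_quadratic {R B M d : ℝ} (hB : 0 ≤ B) (hM : 0 ≤ M)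
    (hd : 0 ≤ d) {u s m g s' m' : ℝ → ℝ} (hu0 : u 0 = 1)
    (hu : ∀ t ∈ Set.Icc 0 R, HasDerivAt u (-(s t * u t)) t)
    (hs : ∀ t ∈ Set.Icc 0 R, HasDerivAt s (s' t) t)
    (hm : ∀ t ∈ Set.Icc 0 R, HasDerivAt m (m' t) t)
    (hs' : ∀ t ∈ Set.Icc 0 R, |s' t - (s t ^ 2 - m t * g t / 2)| ≤ d)
    (hm' : ∀ t ∈ Set.Icc 0 R, |m' t - s t * m t| ≤ d)
    (hg : ∀ t ∈ Set.Icc 0 R, |g t - g 0| ≤ d)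
    (huB : ∀ t ∈ Set.Icc 0 R, |u t| ≤ B) (hgM : ∀ t ∈ Set.Icc 0 R, |g t| ≤ M) (hmM : |m 0| ≤ M)
    {t : ℝ} (ht : t ∈ Set.Icc 0 R) :
    u t ≤ 1 - s 0 * t + m 0 * g 0 * t ^ 2 / 4 + (B + B * R * M + M) * R * R * d := by
  have hR : 0 ≤ R := ht.1.trans ht.2
  have h0 : (0 : ℝ) ∈ Set.Icc 0 R := ⟨le_rfl, hR⟩
  -- the mean value inequality in the form used three times below
  have mvt : ∀ {φ φ' : ℝ → ℝ} {D : ℝ}, (∀ t ∈ Set.Icc 0 R, HasDerivAt φ (φ' t) t) →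
      (∀ t ∈ Set.Icc 0 R, |φ' t| ≤ D) → ∀ t ∈ Set.Icc 0 R, |φ t - φ 0| ≤ D * R := by
    intro φ φ' D h1 h2 t ht
    have := (convex_Icc (0 : ℝ) R).norm_image_sub_le_of_norm_hasDerivWithin_le
      (fun x hx ↦ (h1 x hx).hasDerivWithinAt) (fun x hx ↦ by simpa using h2 x hx) h0 ht
    rw [Real.norm_eq_abs, Real.norm_eq_abs, sub_zero, abs_of_nonneg ht.1] at this
    exact this.trans (mul_le_mul_of_nonneg_left ht.2 ((abs_nonneg _).trans (h2 t ht)))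
  -- `(u m)' = u (m' - s m)` is small, so `u m` is almost constant.
  have hum : ∀ t ∈ Set.Icc 0 R, |u t * m t - m 0| ≤ B * d * R := by
    have := mvt (φ := fun t ↦ u t * m t) (D := B * d)
      (fun t ht ↦ (hu t ht).mul (hm t ht)) (fun t ht ↦ by
        have : -(s t * u t) * m t + u t * m' t = u t * (m' t - s t * m t) := by ring
        rw [this, abs_mul]
        exact mul_le_mul (huB t ht) (hm' t ht) (abs_nonneg _) hB)
    simpa [hu0] using this
  set K := B + B * R * M + M with hK
  -- `u' = -s u` and `u'' = -u (s' - s²)`, which is close to `u m g / 2` and hence to the constant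
  -- `m(0) g(0) / 2`.
  have hp : ∀ t ∈ Set.Icc 0 R, |-(s t * u t) + s 0 - m 0 * g 0 * t / 2| ≤ K * d * R := by
    have := mvt (φ := fun t ↦ -(s t * u t) + s 0 - m 0 * g 0 * t / 2)
      (φ' := fun t ↦ -(s' t * u t + s t * -(s t * u t)) - m 0 * g 0 * 1 / 2) (D := K * d)
      (fun t ht ↦ (((hs t ht).mul (hu t ht)).neg.add_const _).sub
        (((hasDerivAt_id t).const_mul _).div_const _)) (fun t ht ↦ by
        have : -(s' t * u t + s t * -(s t * u t)) - m 0 * g 0 * 1 / 2 =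
            -(u t * (s' t - (s t ^ 2 - m t * g t / 2))) +
              ((u t * m t - m 0) * g t / 2 + m 0 * (g t - g 0) / 2) := by ring
        rw [this]
        have a1 : |u t * (s' t - (s t ^ 2 - m t * g t / 2))| ≤ B * d := by
          rw [abs_mul]; exact mul_le_mul (huB t ht) (hs' t ht) (abs_nonneg _) hB
        have a2 : |(u t * m t - m 0) * g t| ≤ B * d * R * M := by
          rw [abs_mul]; exact mul_le_mul (hum t ht) (hgM t ht) (abs_nonneg _) (by positivity)
        have a3 : |m 0 * (g t - g 0)| ≤ M * d := by
          rw [abs_mul]; exact mul_le_mul hmM (hg t ht) (abs_nonneg _) hM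
        have a4 : 0 ≤ B * d * R * M := by positivity
        have a5 : 0 ≤ M * d := by positivity
        rw [abs_le] at a1 a2 a3 ⊢
        constructor <;> rw [hK] <;> linarith [a1.1, a1.2, a2.1, a2.2, a3.1, a3.2])
    simpa [hu0] using this
  have hfin := mvt (φ := fun t ↦ u t + s 0 * t - m 0 * g 0 * t ^ 2 / 4)
    (φ' := fun t ↦ -(s t * u t) + s 0 * 1 - m 0 * g 0 * (2 * t ^ (2 - 1) * 1) / 4)
    (D := K * d * R) (fun t ht ↦ ((hu t ht).add ((hasDerivAt_id t).const_mul _)).sub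
      ((((hasDerivAt_id t).pow 2).const_mul _).div_const _)) (fun t ht ↦ by
        convert! hp t ht using 2
        simp; ring) t ht
  simp only [hu0, mul_zero, ne_eq, OfNat.ofNat_ne_zero, not_false_eq_true, zero_pow, zero_div,
    add_zero, sub_zero] at hfin
  have := (abs_le.mp hfin).2
  linarith

variable {E : Type*} [NormedAddCommGroup E] [NormedSpace ℝ E]

/-- A map whose derivative is Lipschitz and whose values oscillate little has a small
derivative. -/
lemma norm_fderiv_le_of_small_oscillation {f : E → E} {F : E → E →L[ℝ] E}
    {F₁ : E → E →L[ℝ] E →L[ℝ] E} {z x : E} {τ L δ : ℝ} (hτ : 0 < τ)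
    (hf : ∀ y ∈ Metric.closedBall z τ, HasFDerivAt f (F y) y)
    (hF : ∀ y ∈ Metric.closedBall z τ, HasFDerivAt F (F₁ y) y)
    (hL : ∀ y ∈ Metric.closedBall z τ, ‖F₁ y‖ ≤ L)
    (hδ : ∀ y ∈ Metric.closedBall z τ, f y ∈ Metric.closedBall x δ) :
    ‖F z‖ ≤ 2 * δ / τ + L * τ := by
  have hz : z ∈ Metric.closedBall z τ := Metric.mem_closedBall_self hτ.le
  have hL0 : 0 ≤ L := (norm_nonneg _).trans (hL z hz)
  have hδ0 : 0 ≤ δ := dist_nonneg.trans (Metric.mem_closedBall.mp (hδ z hz))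
  have hconv := convex_closedBall z τ
  have hlip : ∀ y ∈ Metric.closedBall z τ, ‖F y - F z‖ ≤ L * τ := fun y hy ↦
    (hconv.norm_image_sub_le_of_norm_hasFDerivWithin_le
      (fun a ha ↦ (hF a ha).hasFDerivWithinAt) hL hz hy).trans
      (mul_le_mul_of_nonneg_left (mem_closedBall_iff_norm.mp hy) hL0)
  refine ContinuousLinearMap.opNorm_le_of_unit_norm (𝕜 := ℝ) (by positivity) fun v hv ↦ ?_
  have hy : z + τ • v ∈ Metric.closedBall z τ := by
    simp [norm_smul, hv, abs_of_pos hτ]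
  -- First order Taylor expansion at `z`: `F` varies by at most `L τ`, so the remainder at distance
  -- `τ` is at most `L τ²`.
  have h1 := hconv.norm_image_sub_le_of_norm_hasFDerivWithin_le'
    (fun a ha ↦ (hf a ha).hasFDerivWithinAt) hlip hz hy
  have h2 : dist (f (z + τ • v)) (f z) ≤ δ + δ :=
    (dist_triangle_right _ _ x).trans (add_le_add (hδ _ hy) (hδ z hz))
  rw [dist_eq_norm] at h2
  simp only [add_sub_cancel_left, map_smul, norm_smul, hv, Real.norm_eq_abs, abs_of_pos hτ,
    mul_one] at h1
  have h3 : τ * ‖F z v‖ ≤ 2 * δ + L * τ * τ := by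
    have : ‖τ • F z v‖ ≤ ‖f (z + τ • v) - f z‖ + ‖f (z + τ • v) - f z - τ • F z v‖ := by
      rw [← norm_sub_rev (τ • F z v)]
      calc _ = ‖(f (z + τ • v) - f z) + (τ • F z v - (f (z + τ • v) - f z))‖ := by congr 1; abel
        _ ≤ _ := norm_add_le _ _
    rw [norm_smul, Real.norm_eq_abs, abs_of_pos hτ] at this
    linarith
  rw [← mul_le_mul_iff_right₀ hτ]
  refine h3.trans (le_of_eq ?_)
  field_simp

/-- There is a direction in which the quadratic polynomial describing a flat conformal factor
becomes nonpositive in bounded time. -/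
lemma exists_quadratic_nonpos {G : E →L[ℝ] E →L[ℝ] ℝ} {S : (E →L[ℝ] ℝ) →L[ℝ] E} {C R : ℝ}
    (hC : 1 ≤ C) (hR : 32 * C ^ 2 + 8 ≤ R) (hG : ‖G‖ ≤ C) (hSC : ‖S‖ ≤ C)
    (hS : ∀ l, G (S l) = l) {b : E →L[ℝ] ℝ} (hb : ‖b‖ ≤ 1) (hb' : 1 / 2 ≤ ‖b‖) :
    ∃ v : E, ‖v‖ ≤ 1 ∧ ∃ t ∈ Set.Icc 0 R,
      1 - b v * t + b (S b) * G v v * t ^ 2 / 4 ≤ 0 := by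
  have hR0 : 0 < R := by nlinarith
  have hC0 : 0 < C := by linarith
  -- In indefinite signature `b (S b)` may be small although `b` is not. If it is not small, then
  -- along `± S b / C` the polynomial is the square of `1 - |b (S b)| t / (2C)`; otherwise it is
  -- nearly affine.
  by_cases hm : 2 * C / R ≤ |b (S b)|
  · have hmpos : 0 < |b (S b)| := lt_of_lt_of_le (by positivity) hm
    obtain ⟨ε, hε, hεm⟩ : ∃ ε : ℝ, |ε| = 1 ∧ ε * b (S b) = |b (S b)| := by
      rcases abs_cases (b (S b)) with h | h
      · exact ⟨1, by norm_num, by linarith [h.1]⟩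
      · exact ⟨-1, by norm_num, by linarith [h.1]⟩
    refine ⟨(ε / C) • S b, ?_, 2 * C / |b (S b)|, ⟨by positivity, ?_⟩, ?_⟩
    · rw [norm_smul, norm_div, Real.norm_eq_abs, Real.norm_eq_abs, hε, abs_of_pos hC0]
      have : ‖S b‖ ≤ C * 1 := (S.le_opNorm b).trans (by gcongr)
      rw [div_mul_eq_mul_div, div_le_one hC0]; linarith
    · rw [div_le_iff₀ hmpos]; rw [div_le_iff₀ hR0] at hm; linarith
    · simp only [map_smul, smul_apply, smul_eq_mul, hS]
      have e1 : ε / C * b (S b) = |b (S b)| / C := by rw [← hεm]; ring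
      have e2 : b (S b) * (ε / C * (|b (S b)| / C)) = (|b (S b)| / C) ^ 2 := by
        calc _ = (ε * b (S b)) * |b (S b)| / C ^ 2 := by ring
          _ = _ := by rw [hεm]; ring
      rw [e1, e2]
      field_simp
      norm_num
  · push Not at hm
    obtain ⟨v, hv, hbv⟩ := b.exists_lt_apply_of_lt_opNorm
      (show 1 / 4 < ‖b‖ by linarith)
    obtain ⟨w, hw, hbw⟩ : ∃ w : E, ‖w‖ ≤ 1 ∧ 1 / 4 ≤ b w := by
      rcases abs_cases (b v) with h | h
      · exact ⟨v, hv.le, by rw [Real.norm_eq_abs] at hbv; linarith [h.1]⟩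
      · exact ⟨-v, by simpa using hv.le, by rw [Real.norm_eq_abs] at hbv; simp; linarith [h.1]⟩
    -- At `t = 8` the linear term is at most `-2` and the quadratic one at most `16 · (1/16) = 1`.
    refine ⟨w, hw, 8, ⟨by norm_num, by nlinarith⟩, ?_⟩
    have hg : |G w w| ≤ C := by
      have := norm_apply₂_le G w w
      rw [Real.norm_eq_abs] at this
      refine this.trans ?_
      calc ‖G‖ * ‖w‖ * ‖w‖ ≤ C * 1 * 1 := by gcongr
        _ = C := by ring
    have hmg : b (S b) * G w w ≤ 2 * C / R * C := by
      refine (le_abs_self _).trans ?_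
      rw [abs_mul]
      exact mul_le_mul hm.le hg (abs_nonneg _) (by positivity)
    have : 2 * C / R * C ≤ 1 / 16 := by
      rw [div_mul_eq_mul_div, div_le_iff₀ hR0]; nlinarith
    linarith

/-- The jets of a conformal factor `ρ` and a map `f` on a ball, with bounds on the error terms of
the system of equations that they satisfy. -/
structure HasJetBounds (C : ℝ) (K : Set E) (G : E → E →L[ℝ] E →L[ℝ] ℝ)
    (S : E → (E →L[ℝ] ℝ) →L[ℝ] E) (f : E → E) (ρ : E → ℝ) : Prop where
  symm : ∀ y ∈ K, ∀ u v, G y u v = G y v u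
  apply_sharp : ∀ y ∈ K, ∀ l, G y (S y l) = l
  hasFDerivAt_metric : ∀ y ∈ K, HasFDerivAt G (fderiv ℝ G y) y
  hasFDerivAt_sharp : ∀ y ∈ K, HasFDerivAt S (fderiv ℝ S y) y
  hasFDerivAt : ∀ y ∈ K, HasFDerivAt f (fderiv ℝ f y) y
  hasFDerivAt_fderiv : ∀ y ∈ K, HasFDerivAt (fderiv ℝ f) (fderiv ℝ (fderiv ℝ f) y) y
  hasFDerivAt_factor : ∀ y ∈ K, HasFDerivAt ρ (fderiv ℝ ρ y) y
  hasFDerivAt_fderiv_factor : ∀ y ∈ K, HasFDerivAt (fderiv ℝ ρ) (fderiv ℝ (fderiv ℝ ρ) y) y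
  norm_metric_le : ∀ y ∈ K, ‖G y‖ ≤ C
  norm_fderiv_metric_le : ∀ y ∈ K, ‖fderiv ℝ G y‖ ≤ C
  norm_sharp_le : ∀ y ∈ K, ‖S y‖ ≤ C
  norm_fderiv_sharp_le : ∀ y ∈ K, ‖fderiv ℝ S y‖ ≤ C
  norm_hessian_sub_le : ∀ y ∈ K,
    ‖fderiv ℝ (fderiv ℝ ρ) y - ((fderiv ℝ ρ y).smulRight (fderiv ℝ ρ y) -
        (fderiv ℝ ρ y (S y (fderiv ℝ ρ y)) / 2) • G y)‖ ≤
      C * (1 + ‖fderiv ℝ ρ y‖ + ‖fderiv ℝ f y‖ ^ 2)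
  norm_fderiv_fderiv_le : ∀ y ∈ K, ‖fderiv ℝ (fderiv ℝ f) y‖ ≤
      C * ‖fderiv ℝ f y‖ * (1 + ‖fderiv ℝ ρ y‖ + ‖fderiv ℝ f y‖)

namespace HasJetBounds

variable {C : ℝ} {K : Set E} {G : E → E →L[ℝ] E →L[ℝ] ℝ} {S : E → (E →L[ℝ] ℝ) →L[ℝ] E}
  {f : E → E} {ρ : E → ℝ} {y : E}

lemma mono (h : HasJetBounds C K G S f ρ) {K' : Set E} (hK : K' ⊆ K) :
    HasJetBounds C K' G S f ρ where
  symm y hy := h.symm y (hK hy)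
  apply_sharp y hy := h.apply_sharp y (hK hy)
  hasFDerivAt_metric y hy := h.hasFDerivAt_metric y (hK hy)
  hasFDerivAt_sharp y hy := h.hasFDerivAt_sharp y (hK hy)
  hasFDerivAt y hy := h.hasFDerivAt y (hK hy)
  hasFDerivAt_fderiv y hy := h.hasFDerivAt_fderiv y (hK hy)
  hasFDerivAt_factor y hy := h.hasFDerivAt_factor y (hK hy)
  hasFDerivAt_fderiv_factor y hy := h.hasFDerivAt_fderiv_factor y (hK hy)
  norm_metric_le y hy := h.norm_metric_le y (hK hy)
  norm_fderiv_metric_le y hy := h.norm_fderiv_metric_le y (hK hy)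
  norm_sharp_le y hy := h.norm_sharp_le y (hK hy)
  norm_fderiv_sharp_le y hy := h.norm_fderiv_sharp_le y (hK hy)
  norm_hessian_sub_le y hy := h.norm_hessian_sub_le y (hK hy)
  norm_fderiv_fderiv_le y hy := h.norm_fderiv_fderiv_le y (hK hy)

lemma sharp_symm (h : HasJetBounds C K G S f ρ) (hy : y ∈ K) (l k : E →L[ℝ] ℝ) :
    l (S y k) = k (S y l) := by
  rw [← h.apply_sharp y hy l, h.symm y hy, h.apply_sharp y hy, h.apply_sharp y hy]

/-- The derivative of the squared length of `dρ`. -/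
lemma abs_fderiv_normSq_sub_le (h : HasJetBounds C K G S f ρ) (hy : y ∈ K) (v : E) :
    ∃ L : E →L[ℝ] ℝ, HasFDerivAt (fun z ↦ fderiv ℝ ρ z (S z (fderiv ℝ ρ z))) L y ∧
      |L v - fderiv ℝ ρ y v * fderiv ℝ ρ y (S y (fderiv ℝ ρ y))| ≤
        (2 * C ^ 2 * (1 + ‖fderiv ℝ ρ y‖ + ‖fderiv ℝ f y‖ ^ 2) * ‖fderiv ℝ ρ y‖ +
          C * ‖fderiv ℝ ρ y‖ ^ 2) * ‖v‖ := by
  set η := fderiv ℝ ρ y with hη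
  set H := fderiv ℝ (fderiv ℝ ρ) y with hH
  set X := H - (η.smulRight η - (η (S y η) / 2) • G y) with hX
  have hXn : ‖X‖ ≤ C * (1 + ‖η‖ + ‖fderiv ℝ f y‖ ^ 2) := h.norm_hessian_sub_le y hy
  have hC : 0 ≤ C := (norm_nonneg _).trans (h.norm_metric_le y hy)
  refine ⟨_, (h.hasFDerivAt_fderiv_factor y hy).clm_apply
    ((h.hasFDerivAt_sharp y hy).clm_apply (h.hasFDerivAt_fderiv_factor y hy)), ?_⟩
  -- The flat part of the Hessian gives `η(v) |η|² / 2`. By symmetry of `S` it occurs twice in the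
  -- derivative of `|η|²`.
  have e1 : H v (S y η) = η v * η (S y η) / 2 + X v (S y η) := by
    have : G y v (S y η) = η v := by rw [h.symm y hy, h.apply_sharp y hy]
    simp [hX, this]; ring
  have e2 : η (S y (H v)) = H v (S y η) := h.sharp_symm hy _ _
  have : (η ∘L (S y ∘L H + (fderiv ℝ S y).flip η) + H.flip (S y η)) v - η v * η (S y η) =
      2 * X v (S y η) + η (fderiv ℝ S y v η) := by
    simp [e2, e1]; ring
  rw [← hη, ← hH, this]
  have hSη : ‖S y η‖ ≤ C * ‖η‖ := (S y).le_of_opNorm_le (h.norm_sharp_le y hy) η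
  have b1 : |X v (S y η)| ≤ C * (1 + ‖η‖ + ‖fderiv ℝ f y‖ ^ 2) * ‖v‖ * (C * ‖η‖) :=
    (norm_apply₂_le X v _).trans (by gcongr)
  have b2 : |η (fderiv ℝ S y v η)| ≤ ‖η‖ * (C * ‖v‖ * ‖η‖) :=
    (η.le_opNorm _).trans (by
      gcongr
      exact (norm_apply₂_le _ _ _).trans (by gcongr; exact h.norm_fderiv_sharp_le y hy))
  calc _ ≤ 2 * |X v (S y η)| + |η (fderiv ℝ S y v η)| := by
        refine (abs_add_le _ _).trans ?_
        rw [abs_mul, abs_two]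
    _ ≤ _ := by nlinarith

set_option maxHeartbeats 1000000 in
/-- At a point where the jet is nearly maximal at its own scale, the derivative of `f` cannot be
negligible compared to that of `ρ`. -/
theorem rescaled_contradiction {R lam ε d : ℝ} {y₀ : E} (hC : 1 ≤ C) (hR : 32 * C ^ 2 + 8 ≤ R)
    (hlam : 1 ≤ lam) (hε : ε ≤ 1 / 2)
    (h : HasJetBounds C (Metric.closedBall y₀ (R / lam)) G S f ρ)
    (hη : ∀ y ∈ Metric.closedBall y₀ (R / lam), ‖fderiv ℝ ρ y‖ ≤ 2 * lam)
    (hF : ∀ y ∈ Metric.closedBall y₀ (R / lam), ‖fderiv ℝ f y‖ ≤ ε * lam)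
    (h₀ : ‖fderiv ℝ ρ y₀‖ + ‖fderiv ℝ f y₀‖ = lam)
    (hd : 16 * C ^ 2 * (1 + R) * (1 / lam + ε ^ 2) ≤ d)
    (hdR : (Real.exp (2 * R) + Real.exp (2 * R) * R * (4 * C) + 4 * C) * R * R * d <
      Real.exp (-(2 * R))) : False := by
  have hlam0 : 0 < lam := by linarith
  have hR0 : 0 < R := by nlinarith
  have hC0 : 0 < C := by linarith
  have hy₀ : y₀ ∈ Metric.closedBall y₀ (R / lam) := Metric.mem_closedBall_self (by positivity)
  set K := Metric.closedBall y₀ (R / lam) with hK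
  set b : E →L[ℝ] ℝ := (1 / lam) • fderiv ℝ ρ y₀ with hb
  have hbn : ‖b‖ = ‖fderiv ℝ ρ y₀‖ / lam := by
    rw [hb, norm_smul, norm_div, Real.norm_eq_abs, Real.norm_eq_abs, abs_one, abs_of_pos hlam0]
    ring
  have hF0 := hF y₀ hy₀
  -- Since `ε ≤ 1/2`, at most half of the jet at `y₀` comes from `f`, so `‖b‖ ≥ 1/2`.
  obtain ⟨v, hv, t₀, ht₀, hneg⟩ := exists_quadratic_nonpos hC hR (h.norm_metric_le y₀ hy₀)
    (h.norm_sharp_le y₀ hy₀) (h.apply_sharp y₀ hy₀) (b := b)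
    (by rw [hbn, div_le_one hlam0]; linarith [norm_nonneg (fderiv ℝ f y₀)])
    (by rw [hbn, le_div_iff₀ hlam0]; nlinarith)
  set γ : ℝ → E := fun t ↦ y₀ + (t / lam) • v with hγ
  have hγ0 : γ 0 = y₀ := by simp [hγ]
  have hγK : ∀ t ∈ Set.Icc 0 R, γ t ∈ K := by
    intro t ht
    rw [hK, mem_closedBall_iff_norm, hγ]
    simp only [add_sub_cancel_left, norm_smul, Real.norm_eq_abs]
    rw [abs_of_nonneg (div_nonneg ht.1 hlam0.le)]
    calc t / lam * ‖v‖ ≤ R / lam * 1 := by gcongr; exact ht.2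
      _ = _ := mul_one _
  have hγd : ∀ t, HasDerivAt γ ((1 / lam) • v) t := fun t ↦
    (((hasDerivAt_id t).div_const lam).smul_const v).const_add y₀
  have hKc : Convex ℝ K := convex_closedBall _ _
  have hρb : ∀ t ∈ Set.Icc 0 R, |ρ (γ t) - ρ y₀| ≤ 2 * R := by
    intro t ht
    have := hKc.norm_image_sub_le_of_norm_hasFDerivWithin_le
      (fun a ha ↦ (h.hasFDerivAt_factor a ha).hasFDerivWithinAt) hη hy₀ (hγK t ht)
    refine this.trans ?_
    calc 2 * lam * ‖γ t - y₀‖ ≤ 2 * lam * (R / lam) := by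
          gcongr; exact mem_closedBall_iff_norm.mp (hγK t ht)
      _ = 2 * R := by field_simp
  have hlam1 : 1 / lam ≤ 1 := by rw [div_le_one hlam0]; exact hlam
  have hil : 0 ≤ 1 / lam := by positivity
  set e := 1 / lam + ε ^ 2 with he
  have he0 : 0 ≤ e := by positivity
  have hCC : C ≤ C ^ 2 := by nlinarith
  -- Divided by `λ²`, the error of the Hessian equation is of order `e = 1/λ + ε²`.
  have hjet : ∀ y ∈ K, (1 + ‖fderiv ℝ ρ y‖ + ‖fderiv ℝ f y‖ ^ 2) ≤ 3 * e * lam ^ 2 := by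
    intro y hy
    have h1 : ‖fderiv ℝ f y‖ ^ 2 ≤ (ε * lam) ^ 2 := by gcongr; exact hF y hy
    have h2 : 3 * e * lam ^ 2 = 3 * lam + 3 * ε ^ 2 * lam ^ 2 := by
      rw [he]; field_simp
    nlinarith [hη y hy, sq_nonneg (ε * lam)]
  set w := (1 / lam) • v with hw
  have hwn : ‖w‖ ≤ 1 / lam := by
    rw [hw, norm_smul, Real.norm_eq_abs, abs_of_nonneg hil]
    nlinarith
  have hL := fun t ht ↦ h.abs_fderiv_normSq_sub_le (hγK t ht) w
  choose! L hL1 hL2 using hL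
  -- `s`, `m` and `g` are `η(v)` and `|η|²` at scale `λ`, and `G(v, v)`, along the line. As `‖η‖ ≤
  -- 2λ` on a ball of radius `R/λ`, `ρ` varies by at most `2R`, hence `B = e^{2R}`; the same bound
  -- gives `M = 4C`. It also gives `u ≥ e^{-2R}`, which contradicts the conclusion at `t₀`.
  have hmain := inverse_factor_le_quadratic (R := R) (B := Real.exp (2 * R)) (M := 4 * C)
    (d := d) (u := fun t ↦ Real.exp (-(ρ (γ t) - ρ y₀)))
    (s := fun t ↦ fderiv ℝ ρ (γ t) v / lam)
    (m := fun t ↦ fderiv ℝ ρ (γ t) (S (γ t) (fderiv ℝ ρ (γ t))) / lam ^ 2)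
    (g := fun t ↦ G (γ t) v v)
    (s' := fun t ↦ fderiv ℝ (fderiv ℝ ρ) (γ t) w v / lam)
    (m' := fun t ↦ L t w / lam ^ 2)
    (Real.exp_pos _).le (by positivity) (le_trans (by positivity) hd) (by simp [hγ0])
    ?_ ?_ ?_ ?_ ?_ ?_ ?_ ?_ ?_ ht₀
  · simp only [hγ0] at hmain
    have h1 : Real.exp (-(2 * R)) ≤ Real.exp (-(ρ (γ t₀) - ρ y₀)) := by
      apply Real.exp_le_exp.mpr
      linarith [(abs_le.mp (hρb t₀ ht₀)).2]
    have h2 : b v = fderiv ℝ ρ y₀ v / lam := by simp [hb]; ring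
    have h3 : b (S y₀ b) = fderiv ℝ ρ y₀ (S y₀ (fderiv ℝ ρ y₀)) / lam ^ 2 := by
      simp [hb]; ring
    rw [h2, h3] at hneg
    linarith
  · intro t ht
    have := (((h.hasFDerivAt_factor _ (hγK t ht)).comp_hasDerivAt t (hγd t)).sub_const
      (ρ y₀)).neg.exp
    convert! this using 1
    simp [hw, div_eq_inv_mul]; ring
  · intro t ht
    have := (((h.hasFDerivAt_fderiv_factor _ (hγK t ht)).comp_hasDerivAt t (hγd t)).clm_apply
      (hasDerivAt_const t v)).div_const lam
    convert! this using 1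
    simp
  · intro t ht
    exact ((hL1 t ht).comp_hasDerivAt t (hγd t)).div_const _
  · intro t ht
    have h1 := h.norm_hessian_sub_le _ (hγK t ht)
    set X := fderiv ℝ (fderiv ℝ ρ) (γ t) - ((fderiv ℝ ρ (γ t)).smulRight (fderiv ℝ ρ (γ t)) -
      (fderiv ℝ ρ (γ t) (S (γ t) (fderiv ℝ ρ (γ t))) / 2) • G (γ t)) with hX
    have h2 : ‖X‖ ≤ C * (3 * e * lam ^ 2) :=
      h1.trans (mul_le_mul_of_nonneg_left (hjet _ (hγK t ht)) hC0.le)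
    have h3 : |X v v| ≤ C * (3 * e * lam ^ 2) := by
      refine (norm_apply₂_le X v v).trans ?_
      calc ‖X‖ * ‖v‖ * ‖v‖ ≤ C * (3 * e * lam ^ 2) * 1 * 1 := by gcongr
        _ = _ := by ring
    have h4 : fderiv ℝ (fderiv ℝ ρ) (γ t) w v / lam - ((fderiv ℝ ρ (γ t) v / lam) ^ 2 -
        fderiv ℝ ρ (γ t) (S (γ t) (fderiv ℝ ρ (γ t))) / lam ^ 2 * G (γ t) v v / 2) =
        X v v / lam ^ 2 := by
      simp [hX, hw]
      field_simp
    rw [h4, abs_div, abs_of_pos (by positivity : 0 < lam ^ 2), div_le_iff₀ (by positivity)]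
    refine h3.trans ?_
    have h5 : C * (3 * e) ≤ d := by
      refine le_trans ?_ hd
      have : C * e ≤ C ^ 2 * e := by gcongr
      have : 0 ≤ C ^ 2 * R * e := by positivity
      nlinarith
    nlinarith [sq_nonneg lam]
  · intro t ht
    have h1 := hL2 t ht
    set η := fderiv ℝ ρ (γ t)
    have h4 : L t w / lam ^ 2 - η v / lam * (η (S (γ t) η) / lam ^ 2) =
        (L t w - η w * η (S (γ t) η)) / lam ^ 2 := by
      simp [hw]; field_simp
    rw [h4, abs_div, abs_of_pos (by positivity : 0 < lam ^ 2), div_le_iff₀ (by positivity)]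
    refine h1.trans ?_
    have hηt : ‖η‖ ≤ 2 * lam := hη _ (hγK t ht)
    calc (2 * C ^ 2 * (1 + ‖η‖ + ‖fderiv ℝ f (γ t)‖ ^ 2) * ‖η‖ + C * ‖η‖ ^ 2) * ‖w‖ ≤
        (2 * C ^ 2 * (3 * e * lam ^ 2) * (2 * lam) + C ^ 2 * (2 * lam) ^ 2) * (1 / lam) := by
          gcongr; exact hjet _ (hγK t ht)
      _ = (12 * C ^ 2 * e + 4 * C ^ 2 * (1 / lam)) * lam ^ 2 := by field_simp; ring
      _ ≤ d * lam ^ 2 := by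
          gcongr
          refine le_trans ?_ hd
          have : 1 / lam ≤ e := by rw [he]; nlinarith [sq_nonneg ε]
          have : C ^ 2 * (1 / lam) ≤ C ^ 2 * e := by gcongr
          have : 0 ≤ C ^ 2 * R * e := by positivity
          nlinarith
  · intro t ht
    have h1 := hKc.norm_image_sub_le_of_norm_hasFDerivWithin_le
      (fun a ha ↦ (h.hasFDerivAt_metric a ha).hasFDerivWithinAt) h.norm_fderiv_metric_le hy₀
      (hγK t ht)
    have h2 : ‖G (γ t) - G y₀‖ ≤ C * (R / lam) :=
      h1.trans (mul_le_mul_of_nonneg_left (mem_closedBall_iff_norm.mp (hγK t ht)) hC0.le)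
    have h3 : |(G (γ t) - G y₀) v v| ≤ C * (R / lam) * 1 * 1 :=
      (norm_apply₂_le (G (γ t) - G y₀) v v).trans (by gcongr)
    simp only [hγ0]
    simp only [sub_apply] at h3
    refine h3.trans (le_trans ?_ hd)
    have h5 : 1 / lam ≤ e := by rw [he]; nlinarith [sq_nonneg ε]
    have h6 : C * (R / lam) * 1 * 1 = C * R * (1 / lam) := by ring
    rw [h6]
    calc C * R * (1 / lam) ≤ C ^ 2 * R * e := by gcongr
      _ ≤ _ := by
        have : 0 ≤ C ^ 2 * R * e := by positivity
        have : 0 ≤ C ^ 2 * e := by positivity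
        nlinarith
  · intro t ht
    rw [abs_of_pos (Real.exp_pos _)]
    apply Real.exp_le_exp.mpr
    linarith [(abs_le.mp (hρb t ht)).1]
  · intro t ht
    refine (norm_apply₂_le (G (γ t)) v v).trans ?_
    calc ‖G (γ t)‖ * ‖v‖ * ‖v‖ ≤ C * 1 * 1 := by
          gcongr; exact h.norm_metric_le _ (hγK t ht)
      _ ≤ _ := by linarith
  · simp only [hγ0]
    rw [abs_div, abs_of_pos (by positivity : 0 < lam ^ 2), div_le_iff₀ (by positivity)]
    have := hη y₀ hy₀
    calc |fderiv ℝ ρ y₀ (S y₀ (fderiv ℝ ρ y₀))| ≤ ‖fderiv ℝ ρ y₀‖ * (C * ‖fderiv ℝ ρ y₀‖) :=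
          ((fderiv ℝ ρ y₀).le_opNorm _).trans (by
            gcongr; exact (S y₀).le_of_opNorm_le (h.norm_sharp_le y₀ hy₀) _)
      _ ≤ 2 * lam * (C * (2 * lam)) := by gcongr
      _ = _ := by ring

set_option maxHeartbeats 1000000 in
/-- If the values of a conformal map oscillate little on a ball, its jet is bounded on a smaller
ball. -/
theorem exists_bound_of_small_oscillation [FiniteDimensional ℝ E] {C r : ℝ} (hC : 1 ≤ C)
    (hr : 0 < r) :
    ∃ δ > 0, ∃ N : ℝ, ∀ (c x : E) (G : E → E →L[ℝ] E →L[ℝ] ℝ)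
      (S : E → (E →L[ℝ] ℝ) →L[ℝ] E) (f : E → E) (ρ : E → ℝ),
      HasJetBounds C (Metric.closedBall c r) G S f ρ →
      (∀ y ∈ Metric.closedBall c r, f y ∈ Metric.closedBall x δ) →
      ∀ y ∈ Metric.closedBall c (r / 2), ‖fderiv ℝ ρ y‖ + ‖fderiv ℝ f y‖ ≤ N := by
  have hC0 : 0 < C := by linarith
  set R := 32 * C ^ 2 + 8 with hR
  have hR0 : 0 < R := by positivity
  set Q := (Real.exp (2 * R) + Real.exp (2 * R) * R * (4 * C) + 4 * C) * R * R with hQ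
  have hQ0 : 0 < Q := by positivity
  set P := 16 * C ^ 2 * (1 + R) with hP
  have hP0 : 0 < P := by positivity
  -- With `1/λ ≤ q` and `ε² ≤ q`, the total error `Q · P · 2q` is half of the lower bound `e^{-2R}`.
  set q := Real.exp (-(2 * R)) / (4 * Q * P) with hq
  have hq0 : 0 < q := by positivity
  obtain ⟨ε, hε0, hε2, hεq⟩ : ∃ ε : ℝ, 0 < ε ∧ ε ≤ 1 / 2 ∧ ε ^ 2 ≤ q := by
    refine ⟨min (1 / 2) q, by positivity, min_le_left _ _, ?_⟩
    have h1 : min (1 / 2) q ≤ 1 / 2 := min_le_left _ _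
    have h2 : min (1 / 2) q ≤ q := min_le_right _ _
    have h3 : 0 < min (1 / 2) q := by positivity
    nlinarith
  -- On balls of radius `a/λ`, oscillation `δ = aε/4` and `‖D²f‖ ≤ 6Cλ²` each contribute at most
  -- `ελ/2` to `‖Df‖`. This `δ` does not depend on `λ`.
  obtain ⟨a, ha0, ha1, haε⟩ : ∃ a : ℝ, 0 < a ∧ a ≤ 1 ∧ 6 * C * a ≤ ε / 2 := by
    refine ⟨min 1 (ε / (12 * C)), by positivity, min_le_left _ _, ?_⟩
    have := min_le_right 1 (ε / (12 * C))
    calc 6 * C * min 1 (ε / (12 * C)) ≤ 6 * C * (ε / (12 * C)) := by gcongr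
      _ = _ := by field_simp; norm_num
  refine ⟨a * ε / 4, by positivity, max (max 2 (2 / q)) (4 * (R + 1) / r), ?_⟩
  -- The three lower bounds on `N` ensure respectively `λ ≥ 1`, `1/λ ≤ q`, and that the ball of
  -- radius `(R + 1)/λ` stays in the region controlled by the maximum.
  set N := max (max 2 (2 / q)) (4 * (R + 1) / r) with hN
  intro c x G S f ρ h hosc y₁ hy₁
  by_contra hcon
  push Not at hcon
  set μ : E → ℝ := fun y ↦ ‖fderiv ℝ ρ y‖ + ‖fderiv ℝ f y‖ with hμ
  have hμ0 : ∀ y, 0 ≤ μ y := fun y ↦ by positivity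
  -- Point picking: weighting the jet by the distance to the boundary makes the maximum interior,
  -- and within half that distance of it the jet is at most doubled.
  have hcont : ContinuousOn (fun y ↦ (r - dist y c) * μ y) (Metric.closedBall c r) := by
    refine ContinuousOn.mul (by fun_prop) (ContinuousOn.add ?_ ?_)
    · exact ContinuousOn.norm fun y hy ↦
        (h.hasFDerivAt_fderiv_factor y hy).continuousAt.continuousWithinAt
    · exact ContinuousOn.norm fun y hy ↦
        (h.hasFDerivAt_fderiv y hy).continuousAt.continuousWithinAt
  obtain ⟨y₀, hy₀, hmax⟩ := (isCompact_closedBall c r).exists_isMaxOn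
    ⟨c, Metric.mem_closedBall_self hr.le⟩ hcont
  have hN2 : 2 ≤ N := (le_max_left _ _).trans (le_max_left _ _)
  have hNq : 2 / q ≤ N := (le_max_right _ _).trans (le_max_left _ _)
  have hNr : 4 * (R + 1) / r ≤ N := le_max_right _ _
  set dd := r - dist y₀ c with hdd
  set lam := μ y₀ with hlam
  have hbig : r * N / 2 ≤ dd * lam := by
    have h1 : (r - dist y₁ c) * μ y₁ ≤ dd * lam :=
      hmax (Metric.closedBall_subset_closedBall (by linarith) hy₁)
    have h2 : r / 2 ≤ r - dist y₁ c := by linarith [Metric.mem_closedBall.mp hy₁]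
    calc r * N / 2 = r / 2 * N := by ring
      _ ≤ (r - dist y₁ c) * μ y₁ := by gcongr; linarith
      _ ≤ _ := h1
  have hdd0 : 0 ≤ dd := by linarith [Metric.mem_closedBall.mp hy₀]
  have hddr : dd ≤ r := by linarith [dist_nonneg (x := y₀) (y := c)]
  have hlamN : N / 2 ≤ lam := by
    have : dd * lam ≤ r * lam := mul_le_mul_of_nonneg_right hddr (hμ0 _)
    by_contra hlt
    push Not at hlt
    nlinarith
  have hlam1 : 1 ≤ lam := by linarith
  have hlam0 : 0 < lam := by linarith
  have hscale : (R + 1) / lam ≤ dd / 2 := by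
    rw [div_le_iff₀ hlam0]
    rw [div_le_iff₀ hr] at hNr
    linarith
  have hball : ∀ z ∈ Metric.closedBall y₀ ((R + 1) / lam),
      z ∈ Metric.closedBall c r ∧ μ z ≤ 2 * lam := by
    intro z hz
    have h1 : dist z c ≤ dist z y₀ + dist y₀ c := dist_triangle _ _ _
    have h2 : dist z y₀ ≤ dd / 2 := (Metric.mem_closedBall.mp hz).trans hscale
    have hzc : z ∈ Metric.closedBall c r := Metric.mem_closedBall.mpr (by linarith)
    refine ⟨hzc, ?_⟩
    have h3 : (r - dist z c) * μ z ≤ dd * lam := hmax hzc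
    have h4 : dd / 2 * μ z ≤ (r - dist z c) * μ z :=
      mul_le_mul_of_nonneg_right (by linarith) (hμ0 z)
    have h5 : 0 < dd := by
      have : 0 < (R + 1) / lam := by positivity
      linarith
    nlinarith
  have hsub : Metric.closedBall y₀ (R / lam) ⊆ Metric.closedBall y₀ ((R + 1) / lam) :=
    Metric.closedBall_subset_closedBall (by gcongr; linarith)
  have hFsmall : ∀ z ∈ Metric.closedBall y₀ (R / lam), ‖fderiv ℝ f z‖ ≤ ε * lam := by
    intro z hz
    -- The extra `1` in `R + 1` leaves room for a ball of radius `a/λ ≤ 1/λ` around each point of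
    -- the ball of radius `R/λ`.
    have hsub' : Metric.closedBall z (a / lam) ⊆ Metric.closedBall y₀ ((R + 1) / lam) := by
      apply Metric.closedBall_subset_closedBall'
      have : a / lam ≤ 1 / lam := by gcongr
      have h2 := Metric.mem_closedBall.mp hz
      rw [add_div]; linarith
    have key := norm_fderiv_le_of_small_oscillation (f := f) (F := fderiv ℝ f)
      (F₁ := fderiv ℝ (fderiv ℝ f)) (z := z) (x := x) (τ := a / lam) (L := 6 * C * lam ^ 2)
      (δ := a * ε / 4) (by positivity)
      (fun y hy ↦ h.hasFDerivAt y (hball y (hsub' hy)).1)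
      (fun y hy ↦ h.hasFDerivAt_fderiv y (hball y (hsub' hy)).1)
      (fun y hy ↦ by
        obtain ⟨hyc, hyμ⟩ := hball y (hsub' hy)
        refine (h.norm_fderiv_fderiv_le y hyc).trans ?_
        have h1 : ‖fderiv ℝ f y‖ ≤ 2 * lam := by
          linarith [norm_nonneg (fderiv ℝ ρ y)]
        have h2 : 1 + ‖fderiv ℝ ρ y‖ + ‖fderiv ℝ f y‖ ≤ 3 * lam := by linarith
        calc C * ‖fderiv ℝ f y‖ * (1 + ‖fderiv ℝ ρ y‖ + ‖fderiv ℝ f y‖) ≤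
            C * (2 * lam) * (3 * lam) := by gcongr
          _ = _ := by ring)
      (fun y hy ↦ hosc y (hball y (hsub' hy)).1)
    refine key.trans ?_
    have e1 : 2 * (a * ε / 4) / (a / lam) = ε / 2 * lam := by field_simp; norm_num
    have e2 : 6 * C * lam ^ 2 * (a / lam) = 6 * C * a * lam := by field_simp
    rw [e1, e2]
    nlinarith
  refine rescaled_contradiction (R := R) (lam := lam) (ε := ε) (y₀ := y₀)
    (d := P * (2 * q)) hC le_rfl hlam1 hε2
    (h.mono fun z hz ↦ (hball z (hsub hz)).1) (fun z hz ↦ ?_) hFsmall rfl ?_ ?_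
  · have := (hball z (hsub hz)).2
    linarith [norm_nonneg (fderiv ℝ f z)]
  · gcongr
    have : 1 / lam ≤ q := by
      rw [div_le_iff₀ hq0] at hNq
      rw [div_le_iff₀ hlam0]
      nlinarith
    linarith
  · have : Q * (P * (2 * q)) = Real.exp (-(2 * R)) / 2 := by
      rw [hq]; field_simp; norm_num
    rw [this]
    linarith [Real.exp_pos (-(2 * R))]

end HasJetBounds

end Rescaling

/-! ### Uniform metric bounds and the Harnack inequality. -/

section LocalBounds

variable {E : Type*} [NormedAddCommGroup E] [NormedSpace ℝ E]

lemma exists_bound_of_contDiffAt {V : Type*} [NormedAddCommGroup V] [NormedSpace ℝ V]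
    {φ : E → V} {K : Set E} (hK : IsCompact K) (hφ : ∀ y ∈ K, ContDiffAt ℝ ∞ φ y) :
    ∃ C, 0 ≤ C ∧ ∀ y ∈ K, ‖φ y‖ ≤ C ∧ ‖fderiv ℝ φ y‖ ≤ C := by
  obtain ⟨C₁, h₁⟩ := hK.exists_bound_of_continuousOn (f := φ)
    fun y hy ↦ (hφ y hy).continuousAt.continuousWithinAt
  obtain ⟨C₂, h₂⟩ := hK.exists_bound_of_continuousOn (f := fderiv ℝ φ)
    fun y hy ↦ ((hφ y hy).fderiv_right (m := ∞) (by simp)).continuousAt.continuousWithinAt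
  exact ⟨|C₁| + |C₂|, by positivity, fun y hy ↦
    ⟨(h₁ y hy).trans (by linarith [le_abs_self C₁, abs_nonneg C₂]),
      (h₂ y hy).trans (by linarith [le_abs_self C₂, abs_nonneg C₁])⟩⟩

/-- Grönwall's inequality for a map on a convex set. -/
lemma norm_le_of_norm_fderiv_le {V : Type*} [NormedAddCommGroup V] [NormedSpace ℝ V]
    {Φ : E → V} {K : Set E} (hK : Convex ℝ K) {L d : ℝ} (hL : 0 ≤ L)
    (hΦ : ∀ y ∈ K, DifferentiableAt ℝ Φ y) (hb : ∀ y ∈ K, ‖fderiv ℝ Φ y‖ ≤ L * ‖Φ y‖)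
    {y z : E} (hy : y ∈ K) (hz : z ∈ K) (hd : ‖y - z‖ ≤ d) :
    ‖Φ y‖ ≤ ‖Φ z‖ * Real.exp (L * d) := by
  set γ : ℝ → E := ⇑(AffineMap.lineMap (k := ℝ) z y) with hγ
  have hγd : ∀ t, HasDerivAt γ (y - z) t := fun t ↦ AffineMap.hasDerivAt_lineMap
  have hγK : ∀ t ∈ Set.Icc (0 : ℝ) 1, γ t ∈ K := fun t ht ↦ hK.lineMap_mem hz hy ht
  have hΦγ : ∀ t ∈ Set.Icc (0 : ℝ) 1, HasDerivAt (Φ ∘ γ) (fderiv ℝ Φ (γ t) (y - z)) t :=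
    fun t ht ↦ (hΦ _ (hγK t ht)).hasFDerivAt.comp_hasDerivAt t (hγd t)
  have h1 := norm_le_gronwallBound_of_norm_deriv_right_le (f := Φ ∘ γ)
    (f' := fun t ↦ fderiv ℝ Φ (γ t) (y - z)) (δ := ‖Φ z‖) (K := L * d) (ε := 0) (a := 0) (b := 1)
    (fun t ht ↦ (hΦγ t ht).continuousAt.continuousWithinAt)
    (fun t ht ↦ (hΦγ t ⟨ht.1, ht.2.le⟩).hasDerivWithinAt) (by simp [hγ])
    (fun t ht ↦ by
      have ht' : t ∈ Set.Icc (0 : ℝ) 1 := ⟨ht.1, ht.2.le⟩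
      calc _ ≤ ‖fderiv ℝ Φ (γ t)‖ * ‖y - z‖ := ContinuousLinearMap.le_opNorm _ _
        _ ≤ L * ‖Φ (γ t)‖ * d := by gcongr; exact hb _ (hγK t ht')
        _ = _ := by simp; ring)
    1 ⟨zero_le_one, le_rfl⟩
  rw [gronwallBound_ε0] at h1
  simpa [hγ] using h1

/-- From `e^{2ρ} G(v, ·) = G'(Df v, Df ·)`, by inverting `G`. In indefinite signature `e^ρ` does not
control `‖Df v‖` by itself, and this inequality is the substitute. -/
lemma IsConformalOn.exp_mul_norm_le
    {G G' : E → E →L[ℝ] E →L[ℝ] ℝ} {Ω Ω' : Set E} {f : E → E} {ρ : E → ℝ} {y : E} {C : ℝ}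
    (h : IsConformalOn G G' Ω Ω' f ρ) (hy : y ∈ Ω) (hSC : ‖(G y).inverse‖ ≤ C)
    (hGC : ‖G' (f y)‖ ≤ C) (v : E) :
    Real.exp (2 * ρ y) * ‖v‖ ≤ C ^ 2 * ‖fderiv ℝ f y‖ * ‖fderiv ℝ f y v‖ := by
  have hC : 0 ≤ C := (norm_nonneg _).trans hSC
  set F := fderiv ℝ f y
  have h1 : ‖Real.exp (2 * ρ y) • G y v‖ ≤ C * ‖F v‖ * ‖F‖ := by
    refine ContinuousLinearMap.opNorm_le_bound _ (by positivity) fun u ↦ ?_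
    have : (Real.exp (2 * ρ y) • G y v) u = G' (f y) (F v) (F u) := by
      rw [h.conformal y hy]; rfl
    rw [this]
    calc ‖G' (f y) (F v) (F u)‖ ≤ ‖G' (f y)‖ * ‖F v‖ * ‖F u‖ := norm_apply₂_le _ _ _
      _ ≤ C * ‖F v‖ * (‖F‖ * ‖u‖) := by gcongr; exact F.le_opNorm u
      _ = _ := by ring
  have h2 : Real.exp (2 * ρ y) • v = (G y).inverse (Real.exp (2 * ρ y) • G y v) := by
    rw [map_smul, (h.source.isInvertible y hy).inverse_apply_self]
  have h3 := congrArg norm h2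
  rw [norm_smul, Real.norm_of_nonneg (Real.exp_pos _).le] at h3
  rw [h3]
  calc _ ≤ ‖(G y).inverse‖ * ‖Real.exp (2 * ρ y) • G y v‖ := ContinuousLinearMap.le_opNorm _ _
    _ ≤ C * (C * ‖F v‖ * ‖F‖) := by gcongr
    _ = _ := by ring

variable [FiniteDimensional ℝ E]

/-- The Gram determinant of a bilinear form in a fixed basis. -/
def gramDet (B : E →L[ℝ] E →L[ℝ] ℝ) : ℝ :=
  (Matrix.of fun i j ↦ B (Module.finBasis ℝ E i) (Module.finBasis ℝ E j)).det

lemma continuous_gramDet : Continuous (gramDet (E := E)) := by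
  unfold gramDet
  refine Continuous.matrix_det (continuous_matrix fun i j ↦ ?_)
  exact ((ContinuousLinearMap.apply ℝ ℝ (Module.finBasis ℝ E j)).continuous.comp
    (ContinuousLinearMap.apply ℝ (E →L[ℝ] ℝ) (Module.finBasis ℝ E i)).continuous)

lemma gramDet_eq (B : E →L[ℝ] E →L[ℝ] ℝ) :
    gramDet B = (LinearMap.BilinForm.toMatrix (Module.finBasis ℝ E) B.toBilinForm).det := by
  unfold gramDet
  congr 1
  ext i j
  simp

lemma gramDet_smul (a : ℝ) (B : E →L[ℝ] E →L[ℝ] ℝ) :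
    gramDet (a • B) = a ^ Module.finrank ℝ E * gramDet B := by
  have : (Matrix.of fun i j ↦ (a • B) (Module.finBasis ℝ E i) (Module.finBasis ℝ E j)) =
      a • (Matrix.of fun i j ↦ B (Module.finBasis ℝ E i) (Module.finBasis ℝ E j)) := by
    ext i j; simp
  rw [gramDet, this, Matrix.det_smul, Fintype.card_fin, gramDet]

lemma gramDet_pullback (B B' : E →L[ℝ] E →L[ℝ] ℝ) (F : E →L[ℝ] E)
    (h : ∀ u v, B u v = B' (F u) (F v)) : gramDet B = F.det ^ 2 * gramDet B' := by
  have : B.toBilinForm = B'.toBilinForm.comp (F : E →ₗ[ℝ] E) (F : E →ₗ[ℝ] E) := by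
    ext u v; exact h u v
  rw [gramDet_eq, this, LinearMap.BilinForm.toMatrix_comp (Module.finBasis ℝ E),
    Matrix.det_mul, Matrix.det_mul, Matrix.det_transpose, LinearMap.det_toMatrix, gramDet_eq]
  change LinearMap.det (F : E →ₗ[ℝ] E) * _ * LinearMap.det (F : E →ₗ[ℝ] E) =
    LinearMap.det (F : E →ₗ[ℝ] E) ^ 2 * _
  ring

lemma gramDet_ne_zero {B : E →L[ℝ] E →L[ℝ] ℝ} (hB : Function.Injective B)
    (hsymm : ∀ u v, B u v = B v u) : gramDet B ≠ 0 := by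
  rw [gramDet_eq, ← LinearMap.BilinForm.nondegenerate_iff_det_ne_zero]
  have key : ∀ u, (∀ v, B u v = 0) → u = 0 := fun u hu ↦
    hB (by rw [map_zero]; ext v; exact hu v)
  exact ⟨key, fun u hu ↦ key u fun v ↦ by rw [hsymm]; exact hu v⟩

/-- Uniform bounds on a metric and its associated tensors. -/
structure IsMetricOn.HasBounds (G : E → E →L[ℝ] E →L[ℝ] ℝ) (K : Set E) (C : ℝ) : Prop where
  metric : ∀ y ∈ K, ‖G y‖ ≤ C
  fderiv_metric : ∀ y ∈ K, ‖fderiv ℝ G y‖ ≤ C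
  sharp : ∀ y ∈ K, ‖(G y).inverse‖ ≤ C
  fderiv_sharp : ∀ y ∈ K, ‖fderiv ℝ (fun z ↦ (G z).inverse) y‖ ≤ C
  christoffel : ∀ y ∈ K, ‖christoffel G y‖ ≤ C
  fderiv_christoffel : ∀ y ∈ K, ‖fderiv ℝ (ConformalDynamics.christoffel G) y‖ ≤ C
  weylTensor : ∀ y ∈ K, ‖weylTensor (G y) (G y).inverse‖ ≤ C
  fderiv_weylTensor : ∀ y ∈ K,
    ‖fderiv ℝ (fun z ↦ ConformalDynamics.weylTensor (G z) (G z).inverse) y‖ ≤ C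
  gramDet_le : ∀ y ∈ K, |gramDet (G y)| ≤ C
  one_le_gramDet : ∀ y ∈ K, 1 ≤ C * |gramDet (G y)|

lemma IsMetricOn.exists_hasBounds {G : E → E →L[ℝ] E →L[ℝ] ℝ} {Ω K : Set E}
    (h : IsMetricOn G Ω) (hK : IsCompact K) (hKΩ : K ⊆ Ω) :
    ∃ C, 1 ≤ C ∧ IsMetricOn.HasBounds G K C := by
  have : CompleteSpace E := FiniteDimensional.complete ℝ E
  obtain ⟨C₁, p₁, h₁⟩ := exists_bound_of_contDiffAt hK fun y hy ↦ h.contDiffAt (hKΩ hy)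
  obtain ⟨C₂, p₂, h₂⟩ := exists_bound_of_contDiffAt hK fun y hy ↦ h.contDiffAt_inverse (hKΩ hy)
  obtain ⟨C₃, p₃, h₃⟩ := exists_bound_of_contDiffAt hK
    fun y hy ↦ h.contDiffAt_christoffel (hKΩ hy)
  obtain ⟨C₄, p₄, h₄⟩ := exists_bound_of_contDiffAt hK
    fun y hy ↦ h.contDiffAt_weylTensor (hKΩ hy)
  have hgc : ContinuousOn (fun y ↦ gramDet (G y)) K :=
    continuous_gramDet.comp_continuousOn (h.contDiffOn.continuousOn.mono hKΩ)
  have hg0 : ∀ y ∈ K, gramDet (G y) ≠ 0 := fun y hy ↦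
    gramDet_ne_zero (h.isInvertible y (hKΩ hy)).injective (h.symm y (hKΩ hy))
  obtain ⟨C₅, h₅⟩ := hK.exists_bound_of_continuousOn hgc
  obtain ⟨C₆, h₆⟩ := hK.exists_bound_of_continuousOn 
    (f := fun y ↦ (gramDet (G y))⁻¹) (hgc.inv₀ hg0)
  have e5 := le_abs_self C₅
  have e6 := le_abs_self C₆
  have n5 := abs_nonneg C₅
  have n6 := abs_nonneg C₆
  refine ⟨1 + C₁ + C₂ + C₃ + C₄ + |C₅| + |C₆|, by linarith,
    ⟨?_, ?_, ?_, ?_, ?_, ?_, ?_, ?_, ?_, ?_⟩⟩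
    <;> intro y hy
  · exact (h₁ y hy).1.trans (by linarith)
  · exact (h₁ y hy).2.trans (by linarith)
  · exact (h₂ y hy).1.trans (by linarith)
  · exact (h₂ y hy).2.trans (by linarith)
  · exact (h₃ y hy).1.trans (by linarith)
  · exact (h₃ y hy).2.trans (by linarith)
  · exact (h₄ y hy).1.trans (by linarith)
  · exact (h₄ y hy).2.trans (by linarith)
  · exact (h₅ y hy).trans (by linarith)
  · have h1 := h₆ y hy
    have h2 : 0 < |gramDet (G y)| := abs_pos.mpr (hg0 y hy)
    rw [Real.norm_eq_abs, abs_inv, inv_le_iff_one_le_mul₀ h2] at h1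
    refine h1.trans ?_
    gcongr
    linarith

lemma IsMetricOn.HasBounds.mono {G : E → E →L[ℝ] E →L[ℝ] ℝ} {K : Set E} {C C' : ℝ}
    (h : IsMetricOn.HasBounds G K C) (hC : C ≤ C') : IsMetricOn.HasBounds G K C' where
  metric y hy := (h.metric y hy).trans hC
  fderiv_metric y hy := (h.fderiv_metric y hy).trans hC
  sharp y hy := (h.sharp y hy).trans hC
  fderiv_sharp y hy := (h.fderiv_sharp y hy).trans hC
  christoffel y hy := (h.christoffel y hy).trans hC
  fderiv_christoffel y hy := (h.fderiv_christoffel y hy).trans hC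
  weylTensor y hy := (h.weylTensor y hy).trans hC
  fderiv_weylTensor y hy := (h.fderiv_weylTensor y hy).trans hC
  gramDet_le y hy := (h.gramDet_le y hy).trans hC
  one_le_gramDet y hy := (h.one_le_gramDet y hy).trans
    (mul_le_mul_of_nonneg_right hC (abs_nonneg _))

namespace IsConformalOn

variable {G G' : E → E →L[ℝ] E →L[ℝ] ℝ} {Ω Ω' K K' : Set E} {f : E → E} {ρ : E → ℝ}
  {y : E} {C : ℝ}

/-- The constant involves the dimension and the two metrics only, hence is common to all maps of the
sequence. -/
lemma hasJetBounds (h : IsConformalOn G G' Ω Ω' f ρ) (hn : 3 ≤ Module.finrank ℝ E) (hC : 1 ≤ C)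
    (hKΩ : K ⊆ Ω) (hf : Set.MapsTo f K K')
    (hG : IsMetricOn.HasBounds G K C) (hG' : IsMetricOn.HasBounds G' K' C) :
    HasJetBounds (C + (1 + ‖endTrace E‖ * C * C) * (‖endTrace E‖ * (4 * (C + C ^ 2)))) K G
      (fun z ↦ (G z).inverse) f ρ := by
  have : CompleteSpace E := FiniteDimensional.complete ℝ E
  set D := (1 + ‖endTrace E‖ * C * C) * (‖endTrace E‖ * (4 * (C + C ^ 2))) with hD
  have hD0 : 0 ≤ D := by positivity
  have hCD : C ≤ C + D := by linarith
  constructor <;> intro y hy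
  · exact h.source.symm y (hKΩ hy)
  · exact (h.source.isInvertible y (hKΩ hy)).self_apply_inverse
  · exact ((h.source.contDiffAt (hKΩ hy)).differentiableAt (by simp)).hasFDerivAt
  · exact ((h.source.contDiffAt_inverse (hKΩ hy)).differentiableAt (by simp)).hasFDerivAt
  · exact h.hasFDerivAt (hKΩ hy)
  · exact h.hasFDerivAt_fderiv (hKΩ hy)
  · exact h.hasFDerivAt_factor (hKΩ hy)
  · exact h.hasFDerivAt_fderiv_factor (hKΩ hy)
  · exact (hG.metric y hy).trans hCD
  · exact (hG.fderiv_metric y hy).trans hCD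
  · exact (hG.sharp y hy).trans hCD
  · exact (hG.fderiv_sharp y hy).trans hCD
  · refine (h.norm_hessian_sub_le (hKΩ hy) hn (hG.christoffel y hy) (hG.fderiv_christoffel y hy)
      (hG'.christoffel _ (hf hy)) (hG'.fderiv_christoffel _ (hf hy)) (hG.fderiv_weylTensor y hy)
      (hG.weylTensor y hy) (hG.sharp y hy) (hG.metric y hy)).trans ?_
    rw [← mul_assoc, ← hD]
    gcongr
    linarith
  · refine (h.norm_fderiv_fderiv_le (hKΩ hy) (hG.christoffel y hy)
      (hG'.christoffel _ (hf hy)) (hG.weylTensor y hy)).trans ?_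
    gcongr

/-- Gram determinants of both sides of `e^{2ρ} G = f^*G'`. As those of the metrics are bounded above
and away from zero, `|det Df|` is comparable to `e^{nρ}`. -/
lemma exp_pow_mul_gramDet (h : IsConformalOn G G' Ω Ω' f ρ) (hy : y ∈ Ω) :
    Real.exp (Module.finrank ℝ E * ρ y) ^ 2 * gramDet (G y) =
      (fderiv ℝ f y).det ^ 2 * gramDet (G' (f y)) := by
  rw [← gramDet_pullback (Real.exp (2 * ρ y) • G y) (G' (f y)) (fderiv ℝ f y)
    (fun u v ↦ (h.conformal y hy u v).symm), gramDet_smul, ← Real.exp_nat_mul,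
    ← Real.exp_nat_mul]
  congr 2
  push_cast; ring

lemma abs_det_le (h : IsConformalOn G G' Ω Ω' f ρ) (hy : y ∈ Ω) (hC : 1 ≤ C)
    (hG : |gramDet (G y)| ≤ C) (hG' : 1 ≤ C * |gramDet (G' (f y))|) :
    |(fderiv ℝ f y).det| ≤ C * Real.exp (Module.finrank ℝ E * ρ y) := by
  have h1 := congrArg abs (h.exp_pow_mul_gramDet hy)
  rw [abs_mul, abs_mul, abs_pow, abs_pow, abs_of_pos (Real.exp_pos _)] at h1
  refine abs_le_of_sq_le_sq' ?_ (by positivity) |>.2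
  have h2 : |(fderiv ℝ f y).det| ^ 2 ≤ |(fderiv ℝ f y).det| ^ 2 * (C * |gramDet (G' (f y))|) :=
    le_mul_of_one_le_right (sq_nonneg _) hG'
  calc _ ≤ C * (|(fderiv ℝ f y).det| ^ 2 * |gramDet (G' (f y))|) := by linarith
    _ ≤ C * (Real.exp (Module.finrank ℝ E * ρ y) ^ 2 * C) := by rw [← h1]; gcongr
    _ = _ := by ring

lemma exp_le_abs_det (h : IsConformalOn G G' Ω Ω' f ρ) (hy : y ∈ Ω) (hC : 1 ≤ C)
    (hG : 1 ≤ C * |gramDet (G y)|) (hG' : |gramDet (G' (f y))| ≤ C) :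
    Real.exp (Module.finrank ℝ E * ρ y) ≤ C * |(fderiv ℝ f y).det| := by
  have h1 := congrArg abs (h.exp_pow_mul_gramDet hy)
  rw [abs_mul, abs_mul, abs_pow, abs_pow, abs_of_pos (Real.exp_pos _)] at h1
  refine abs_le_of_sq_le_sq' ?_ (by positivity) |>.2
  have h2 : Real.exp (Module.finrank ℝ E * ρ y) ^ 2 ≤
      Real.exp (Module.finrank ℝ E * ρ y) ^ 2 * (C * |gramDet (G y)|) :=
    le_mul_of_one_le_right (sq_nonneg _) hG
  calc _ ≤ C * (Real.exp (Module.finrank ℝ E * ρ y) ^ 2 * |gramDet (G y)|) := by linarith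
    _ ≤ C * (|(fderiv ℝ f y).det| ^ 2 * C) := by rw [h1]; gcongr
    _ = _ := by ring

end IsConformalOn

/-- Comparison of the jets at two points of a conformal map that collapses a ball. -/
theorem exists_harnack_bounds (hn : 3 ≤ Module.finrank ℝ E)
    {G G' : E → E →L[ℝ] E →L[ℝ] ℝ} {Ω Ω' : Set E} (hG : IsMetricOn G Ω) (hG' : IsMetricOn G' Ω')
    {c x : E} {r : ℝ} (hr : 0 < r) (hc : Metric.closedBall c r ⊆ Ω) (hx : x ∈ Ω') :
    ∃ δ > 0, Metric.closedBall x δ ⊆ Ω' ∧ ∃ A : ℝ, 1 ≤ A ∧ ∀ (Ω₁ : Set E) (f : E → E) (ρ : E → ℝ),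
      Metric.closedBall c r ⊆ Ω₁ → IsConformalOn G G' Ω₁ Ω' f ρ →
      Set.MapsTo f (Metric.closedBall c r) (Metric.closedBall x δ) →
      ∀ y ∈ Metric.closedBall c (r / 2),
        (∀ z ∈ Metric.closedBall c (r / 2), ρ y ≤ ρ z + A ∧
          ‖fderiv ℝ f y‖ ≤ A * ‖fderiv ℝ f z‖) ∧
        (∀ v, Real.exp (2 * ρ y) * ‖v‖ ≤ A * ‖fderiv ℝ f y‖ * ‖fderiv ℝ f y v‖) ∧
        |(fderiv ℝ f y).det| ≤ A * Real.exp (Module.finrank ℝ E * ρ y) ∧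
        Real.exp (Module.finrank ℝ E * ρ y) ≤ A * |(fderiv ℝ f y).det| := by
  obtain ⟨δ₀, hδ₀, hδ₀Ω⟩ := Metric.nhds_basis_closedBall.mem_iff.mp (hG'.isOpen.mem_nhds hx)
  obtain ⟨C₁, hC₁, hB₁⟩ := hG.exists_hasBounds (isCompact_closedBall c r) hc
  obtain ⟨C₂, hC₂, hB₂⟩ := hG'.exists_hasBounds (isCompact_closedBall x δ₀) hδ₀Ω
  set C := max C₁ C₂ with hCdef
  have hC : 1 ≤ C := hC₁.trans (le_max_left _ _)
  have hB := hB₁.mono (le_max_left C₁ C₂)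
  have hB' := hB₂.mono (le_max_right C₁ C₂)
  rw [← hCdef] at hB hB'
  set D := C + (1 + ‖endTrace E‖ * C * C) * (‖endTrace E‖ * (4 * (C + C ^ 2))) with hDdef
  have hD : 1 ≤ D := hC.trans (le_add_of_nonneg_right (by positivity))
  obtain ⟨δ₁, hδ₁, N, hN⟩ := HasJetBounds.exists_bound_of_small_oscillation (E := E) hD hr
  have hNn := abs_nonneg N
  -- The summands serve the inequality for `e^{2ρ} ‖v‖`, the oscillation of `ρ` and Grönwall's
  -- inequality for `Df`.
  set A := C ^ 2 + |N| * r + Real.exp (D * (1 + |N|) * r) with hA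
  have hA2 : C ^ 2 ≤ A := by
    have : 0 ≤ |N| * r := by positivity
    linarith [Real.exp_pos (D * (1 + |N|) * r)]
  have hAN : |N| * r ≤ A := by
    linarith [Real.exp_pos (D * (1 + |N|) * r), sq_nonneg C]
  have hAe : Real.exp (D * (1 + |N|) * r) ≤ A := by
    have : 0 ≤ |N| * r := by positivity
    linarith [sq_nonneg C]
  have hCA : C ≤ A := by nlinarith
  -- `δ₀` keeps the image where the target metric is controlled; `δ₁` is the oscillation threshold
  -- for the jet bound.
  refine ⟨min δ₀ δ₁, lt_min hδ₀ hδ₁,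
    (Metric.closedBall_subset_closedBall (min_le_left _ _)).trans hδ₀Ω, A, hC.trans hCA, ?_⟩
  intro Ω₁ f ρ hcΩ₁ h hmaps y hy
  have hjet := h.hasJetBounds hn hC hcΩ₁
    (fun z hz ↦ Metric.closedBall_subset_closedBall (min_le_left _ _) (hmaps hz)) hB hB'
  have hbound := hN c x G _ f ρ hjet
    (fun z hz ↦ Metric.closedBall_subset_closedBall (min_le_right _ _) (hmaps hz))
  have hsub : Metric.closedBall c (r / 2) ⊆ Metric.closedBall c r :=
    Metric.closedBall_subset_closedBall (by linarith)
  have hyK := hsub hy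
  have hfy : f y ∈ Metric.closedBall x δ₀ :=
    Metric.closedBall_subset_closedBall (min_le_left _ _) (hmaps hyK)
  have hconv := convex_closedBall c (r / 2)
  refine ⟨fun z hz ↦ ?_, fun v ↦ ?_, ?_, ?_⟩
  · have hyz : ‖y - z‖ ≤ r := by
      rw [← dist_eq_norm]
      linarith [dist_triangle_right y z c, Metric.mem_closedBall.mp hy,
        Metric.mem_closedBall.mp hz]
    constructor
    · have := hconv.norm_image_sub_le_of_norm_hasFDerivWithin_le
        (fun a ha ↦ (hjet.hasFDerivAt_factor a (hsub ha)).hasFDerivWithinAt) (C := |N|)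
        (fun a ha ↦ by linarith [hbound a ha, norm_nonneg (fderiv ℝ f a), le_abs_self N]) hz hy
      have h2 : |N| * ‖y - z‖ ≤ |N| * r := by gcongr
      rw [Real.norm_eq_abs] at this
      linarith [le_abs_self (ρ y - ρ z)]
    · have := norm_le_of_norm_fderiv_le hconv (Φ := fderiv ℝ f) (L := D * (1 + |N|))
        (by positivity) (fun a ha ↦ (hjet.hasFDerivAt_fderiv a (hsub ha)).differentiableAt)
        (fun a ha ↦ by
          refine (hjet.norm_fderiv_fderiv_le a (hsub ha)).trans ?_
          calc D * ‖fderiv ℝ f a‖ * (1 + ‖fderiv ℝ ρ a‖ + ‖fderiv ℝ f a‖) ≤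
              D * ‖fderiv ℝ f a‖ * (1 + |N|) := by
                gcongr ?_ * ?_
                linarith [hbound a ha, le_abs_self N]
            _ = _ := by ring) hy hz hyz
      refine this.trans ?_
      rw [mul_comm]
      gcongr
  · refine (h.exp_mul_norm_le (hcΩ₁ hyK) (hB.sharp y hyK) (hB'.metric _ hfy) v).trans ?_
    gcongr
  · exact (h.abs_det_le (hcΩ₁ hyK) hC (hB.gramDet_le y hyK) (hB'.one_le_gramDet _ hfy)).trans
      (by gcongr)
  · exact (h.exp_le_abs_det (hcΩ₁ hyK) hC (hB.one_le_gramDet y hyK) (hB'.gramDet_le _ hfy)).trans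
      (by gcongr)

end LocalBounds

/-! ### Exponential growth rates. -/

section Rates

variable {T : ℕ → ℝ} {χ : ℝ}

/-- The sequence `a` has exponential growth rate `χ` at speed `T`. -/
def HasRate (T a : ℕ → ℝ) (χ : ℝ) : Prop :=
  Tendsto (fun k ↦ 1 / T k * Real.log (a k)) atTop (𝓝 χ)

lemma tendsto_one_div_mul_const (hT : Tendsto T atTop atTop) (c : ℝ) :
    Tendsto (fun k ↦ 1 / T k * c) atTop (𝓝 0) := by
  have := (tendsto_inv_atTop_zero.comp hT).mul_const c
  simpa using this

/-- A bounded factor changes the logarithm by a bounded amount, which disappears after division by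
`T k → ∞`. -/
lemma HasRate.of_comparable (hT : Tendsto T atTop atTop) {a b : ℕ → ℝ} {A : ℝ} (hA : 1 ≤ A)
    (ha : HasRate T a χ) (hpos : ∀ᶠ k in atTop, 0 < a k) (hba : ∀ᶠ k in atTop, b k ≤ A * a k)
    (hab : ∀ᶠ k in atTop, a k ≤ A * b k) : HasRate T b χ := by
  have hA0 : 0 < A := by linarith
  have hdiff : Tendsto (fun k ↦ 1 / T k * (Real.log (b k) - Real.log (a k))) atTop (𝓝 0) := by
    refine squeeze_zero_norm' ?_ (tendsto_one_div_mul_const hT (Real.log A))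
    filter_upwards [hpos, hba, hab, hT.eventually_gt_atTop 0] with k h1 h2 h3 h4
    have hb : 0 < b k := by
      by_contra hle
      push Not at hle
      nlinarith
    have e1 : Real.log (b k) ≤ Real.log A + Real.log (a k) := by
      rw [← Real.log_mul hA0.ne' h1.ne']; exact Real.log_le_log hb h2
    have e2 : Real.log (a k) ≤ Real.log A + Real.log (b k) := by
      rw [← Real.log_mul hA0.ne' hb.ne']; exact Real.log_le_log h1 h3
    rw [norm_mul, Real.norm_of_nonneg (by positivity : 0 ≤ 1 / T k)]
    gcongr
    rw [Real.norm_eq_abs, abs_le]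
    constructor <;> linarith
  have := ha.add hdiff
  rw [add_zero] at this
  refine this.congr fun k ↦ ?_
  ring

variable {E : Type*} [NormedAddCommGroup E] [NormedSpace ℝ E]

lemma hasRate_exp_iff (n : ℕ) (hn : n ≠ 0) (ρ : ℕ → ℝ) :
    HasRate T (fun k ↦ Real.exp (n * ρ k)) (n * χ) ↔
      Tendsto (fun k ↦ 1 / T k * ρ k) atTop (𝓝 χ) := by
  have hn' : (n : ℝ) ≠ 0 := by exact_mod_cast hn
  have : (fun k ↦ 1 / T k * Real.log (Real.exp (n * ρ k))) =
      fun k ↦ n * (1 / T k * ρ k) := by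
    ext k; rw [Real.log_exp]; ring
  unfold HasRate
  rw [this]
  constructor
  · intro h
    have := h.const_mul (n : ℝ)⁻¹
    simpa [← mul_assoc, inv_mul_cancel₀ hn'] using this
  · exact fun h ↦ h.const_mul _

/-- The norms of linear maps grow at the rate common to all nonzero vectors. -/
lemma hasRate_opNorm [FiniteDimensional ℝ E] [Nontrivial E] (hT : Tendsto T atTop atTop)
    {F : ℕ → E →L[ℝ] E} (hinj : ∀ᶠ k in atTop, Function.Injective (F k))
    (h : ∀ v ≠ 0, HasRate T (fun k ↦ ‖F k v‖) χ) : HasRate T (fun k ↦ ‖F k‖) χ := by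
  let b := Module.finBasis ℝ E
  obtain ⟨C, hC, hb⟩ := b.exists_opNorm_le (F := E)
  obtain ⟨v, hv⟩ := exists_ne (0 : E)
  have hv0 : 0 < ‖v‖ := norm_pos_iff.mpr hv
  refine tendsto_order.mpr ⟨fun a ha ↦ ?_, fun a ha ↦ ?_⟩
  · have h1 := (h v hv).add (tendsto_one_div_mul_const hT (-Real.log ‖v‖))
    rw [add_zero] at h1
    filter_upwards [(tendsto_order.mp h1).1 a ha, hinj, hT.eventually_gt_atTop 0] with k hk hi hTk
    refine hk.trans_le ?_
    rw [← mul_add]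
    gcongr
    have hFv : 0 < ‖F k v‖ := norm_pos_iff.mpr fun h0 ↦ hv (hi (by rw [h0, map_zero]))
    have := Real.log_le_log hFv ((F k).le_opNorm v)
    have hF : ‖F k‖ ≠ 0 := fun h0 ↦ by
      have := (F k).le_opNorm v
      rw [h0] at this; linarith
    rw [Real.log_mul hF hv0.ne'] at this
    linarith
  · obtain ⟨m, hm1, hm2⟩ := exists_between ha
    -- For the upper bound the finitely many vectors of a basis control the operator norm up to `C`;
    -- the lower bound needed a single vector.
    have h1 : ∀ᶠ k in atTop, ∀ i, 1 / T k * Real.log ‖F k (b i)‖ < m :=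
      eventually_all.mpr fun i ↦ (tendsto_order.mp (h (b i) (b.ne_zero i))).2 m hm1
    have h2 := (tendsto_order.mp (tendsto_one_div_mul_const hT (Real.log C))).2 (a - m)
      (by linarith)
    filter_upwards [h1, h2, hinj, hT.eventually_gt_atTop 0] with k hk1 hk2 hi hTk
    have h3 : ∀ i, ‖F k (b i)‖ ≤ Real.exp (m * T k) := by
      intro i
      have hpos : 0 < ‖F k (b i)‖ :=
        norm_pos_iff.mpr fun h0 ↦ b.ne_zero i (hi (by rw [h0, map_zero]))
      rw [← Real.log_le_iff_le_exp hpos]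
      have := hk1 i
      rw [one_div_mul_eq_div, div_lt_iff₀ hTk] at this
      exact this.le
    have h4 := hb (Real.exp_pos (m * T k)).le h3
    have hF : 0 < ‖F k‖ := norm_pos_iff.mpr fun h0 ↦ by
      apply hv; apply hi; simp [h0]
    have h5 := Real.log_le_log hF h4
    rw [Real.log_mul hC.ne' (Real.exp_pos _).ne', Real.log_exp] at h5
    calc 1 / T k * Real.log ‖F k‖ ≤ 1 / T k * (Real.log C + m * T k) := by gcongr
      _ = 1 / T k * Real.log C + m := by field_simp
      _ < a := by linarith

/-- The upper bound is `‖F v‖ ≤ ‖F‖ ‖v‖`; the lower one is the rate `2χ` of `e^{2ρ}` minus the rate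
`χ` of `‖F‖`. -/
lemma hasRate_norm_apply (hT : Tendsto T atTop atTop)
    {F : ℕ → E →L[ℝ] E} {ρ : ℕ → ℝ} {A : ℝ} (hA : 1 ≤ A)
    (hF : ∀ᶠ k in atTop, ∀ v, Real.exp (2 * ρ k) * ‖v‖ ≤ A * ‖F k‖ * ‖F k v‖)
    (hrate : HasRate T (fun k ↦ ‖F k‖) χ) (hρ : Tendsto (fun k ↦ 1 / T k * ρ k) atTop (𝓝 χ))
    {v : E} (hv : v ≠ 0) : HasRate T (fun k ↦ ‖F k v‖) χ := by
  have hv0 : 0 < ‖v‖ := norm_pos_iff.mpr hv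
  have hA0 : 0 < A := by linarith
  have hlow := ((hρ.const_mul 2).sub hrate).add
    (tendsto_one_div_mul_const hT (Real.log ‖v‖ - Real.log A))
  have hup := hrate.add (tendsto_one_div_mul_const hT (Real.log ‖v‖))
  rw [add_zero] at hlow hup
  rw [show 2 * χ - χ = χ by ring] at hlow
  have hpos : ∀ᶠ k in atTop, 0 < ‖F k‖ ∧ 0 < ‖F k v‖ := by
    filter_upwards [hF] with k hk
    have h1 : 0 < A * ‖F k‖ * ‖F k v‖ := lt_of_lt_of_le (by positivity) (hk v)
    constructor
    · refine (norm_nonneg _).lt_of_ne' fun h0 ↦ ?_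
      simp [h0] at h1
    · refine (norm_nonneg _).lt_of_ne' fun h0 ↦ ?_
      simp [h0] at h1
  refine tendsto_of_tendsto_of_tendsto_of_le_of_le' hlow hup ?_ ?_
  · filter_upwards [hF, hpos, hT.eventually_gt_atTop 0] with k hk hp hTk
    have h1 := Real.log_le_log (by positivity) (hk v)
    rw [Real.log_mul (Real.exp_pos _).ne' hv0.ne', Real.log_exp,
      Real.log_mul (mul_pos hA0 hp.1).ne' hp.2.ne', Real.log_mul hA0.ne' hp.1.ne'] at h1
    calc _ = 1 / T k * (2 * ρ k - Real.log ‖F k‖ + (Real.log ‖v‖ - Real.log A)) := by ring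
      _ ≤ _ := by gcongr; linarith
  · filter_upwards [hpos, hT.eventually_gt_atTop 0] with k hp hTk
    have h1 := Real.log_le_log hp.2 ((F k).le_opNorm v)
    rw [Real.log_mul hp.1.ne' hv0.ne'] at h1
    rw [← mul_add]
    gcongr

end Rates

/-! ### Conformal diffeomorphisms read in charts. -/

section Charts

variable {n : ℕ} {M : Type*} [TopologicalSpace M]
  [ChartedSpace (EuclideanSpace ℝ (Fin n)) M]

/-- A map read in the charts at `y₀` and `x₀`. -/
def localRep (y₀ x₀ : M) (f : M → M) : EuclideanSpace ℝ (Fin n) → EuclideanSpace ℝ (Fin n) :=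
  extChartAt (𝓡 n) x₀ ∘ f ∘ (extChartAt (𝓡 n) y₀).symm

/-- The domain of the map `localRep y₀ x₀ f`. -/
def localDomain (y₀ x₀ : M) (f : M → M) : Set (EuclideanSpace ℝ (Fin n)) :=
  (extChartAt (𝓡 n) y₀).target ∩
    (extChartAt (𝓡 n) y₀).symm ⁻¹' (f ⁻¹' (extChartAt (𝓡 n) x₀).source)

lemma isOpen_localDomain (y₀ x₀ : M) {f : M → M} (hf : Continuous f) :
    IsOpen (localDomain y₀ x₀ f : Set (EuclideanSpace ℝ (Fin n))) :=
  (continuousOn_extChartAt_symm y₀).isOpen_inter_preimage (isOpen_extChartAt_target y₀)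
    ((isOpen_extChartAt_source x₀).preimage hf)

variable [IsManifold (𝓡 n) ∞ M]

/-- The coordinate frame at `z` of the chart at `x₀`. -/
def coordFrame (x₀ z : M) : EuclideanSpace ℝ (Fin n) →L[ℝ] TangentSpace (𝓡 n) z :=
  (trivializationAt (EuclideanSpace ℝ (Fin n)) (TangentSpace (𝓡 n)) x₀).symmL ℝ z

/-- The inverse of the coordinate frame at `z` of the chart at `x₀`. -/
def coordCoframe (x₀ z : M) : TangentSpace (𝓡 n) z →L[ℝ] EuclideanSpace ℝ (Fin n) :=
  (trivializationAt (EuclideanSpace ℝ (Fin n)) (TangentSpace (𝓡 n)) x₀).continuousLinearMapAt ℝ z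

lemma coordFrame_coordCoframe {x₀ z : M} (hz : z ∈ (extChartAt (𝓡 n) x₀).source)
    (v : TangentSpace (𝓡 n) z) : coordFrame x₀ z (coordCoframe x₀ z v) = v :=
  (trivializationAt (EuclideanSpace ℝ (Fin n)) (TangentSpace (𝓡 n)) x₀).symmL_continuousLinearMapAt
    (by simpa using hz) v

lemma coordCoframe_coordFrame {x₀ z : M} (hz : z ∈ (extChartAt (𝓡 n) x₀).source)
    (v : EuclideanSpace ℝ (Fin n)) : coordCoframe x₀ z (coordFrame x₀ z v) = v :=
  (trivializationAt (EuclideanSpace ℝ (Fin n)) (TangentSpace (𝓡 n)) x₀).continuousLinearMapAt_symmL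
    (by simpa using hz) v

/-- The section is constant in the trivialization at `x₀`. -/
lemma contMDiffOn_coordFrame (x₀ : M) (u : EuclideanSpace ℝ (Fin n)) :
    ContMDiffOn (𝓡 n) ((𝓡 n).prod 𝓘(ℝ, EuclideanSpace ℝ (Fin n))) ∞
      (fun z ↦ TotalSpace.mk' (EuclideanSpace ℝ (Fin n)) z (coordFrame x₀ z u))
      (extChartAt (𝓡 n) x₀).source := by
  set e := trivializationAt (EuclideanSpace ℝ (Fin n)) (TangentSpace (𝓡 n) (M := M)) x₀ with he
  have hs : (extChartAt (𝓡 n) x₀).source = e.baseSet := by simp [he]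
  rw [hs, e.contMDiffOn_section_baseSet_iff]
  refine (contMDiffOn_const (c := u)).congr fun z hz ↦ ?_
  have h1 : coordFrame x₀ z u = e.symm z u := e.symmL_apply hz u
  rw [h1, e.apply_mk_symm hz u]

/-- A field of bilinear forms on the tangent spaces, in the coordinates of the chart at `x₀`. -/
def coordForm (B : ∀ z : M, TangentSpace (𝓡 n) z →L[ℝ] TangentSpace (𝓡 n) z →L[ℝ] ℝ) (x₀ : M)
    (p : EuclideanSpace ℝ (Fin n)) :
    EuclideanSpace ℝ (Fin n) →L[ℝ] EuclideanSpace ℝ (Fin n) →L[ℝ] ℝ :=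
  (ContinuousLinearMap.precomp ℝ (coordFrame x₀ ((extChartAt (𝓡 n) x₀).symm p))) ∘L
    B ((extChartAt (𝓡 n) x₀).symm p) ∘L coordFrame x₀ ((extChartAt (𝓡 n) x₀).symm p)

variable {B : ∀ z : M, TangentSpace (𝓡 n) z →L[ℝ] TangentSpace (𝓡 n) z →L[ℝ] ℝ}

lemma coordForm_apply (x₀ : M) (p u v : EuclideanSpace ℝ (Fin n)) :
    coordForm B x₀ p u v = B ((extChartAt (𝓡 n) x₀).symm p)
      (coordFrame x₀ ((extChartAt (𝓡 n) x₀).symm p) u)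
      (coordFrame x₀ ((extChartAt (𝓡 n) x₀).symm p) v) := rfl

lemma contDiffOn_coordForm
    (hB : ContMDiff (𝓡 n) ((𝓡 n).prod
      𝓘(ℝ, EuclideanSpace ℝ (Fin n) →L[ℝ] EuclideanSpace ℝ (Fin n) →L[ℝ] ℝ)) ∞
      (fun y ↦ TotalSpace.mk' (EuclideanSpace ℝ (Fin n) →L[ℝ] EuclideanSpace ℝ (Fin n) →L[ℝ] ℝ)
        y (B y))) (x₀ : M) :
    ContDiffOn ℝ ∞ (coordForm B x₀) (extChartAt (𝓡 n) x₀).target := by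
  refine contDiffOn_clm_apply.mpr fun u ↦ contDiffOn_clm_apply.mpr fun v ↦ ?_
  have h1 : ContMDiffOn (𝓡 n) 𝓘(ℝ, ℝ) ∞
      (fun z ↦ B z (coordFrame x₀ z u) (coordFrame x₀ z v)) (extChartAt (𝓡 n) x₀).source := by
    intro z hz
    have := ContMDiffWithinAt.clm_bundle_apply₂ (F₃ := ℝ) (E₃ := Bundle.Trivial M ℝ)
      (hB.contMDiffOn z hz) (contMDiffOn_coordFrame x₀ u z hz) (contMDiffOn_coordFrame x₀ v z hz)
    exact (contMDiffWithinAt_totalSpace.mp this).2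
  exact contMDiffOn_iff_contDiffOn.mp (h1.comp (contMDiffOn_extChartAt_symm x₀)
    fun p hp ↦ (extChartAt (𝓡 n) x₀).map_target hp)

lemma IsMetricOn.mono {E : Type*} [NormedAddCommGroup E] [NormedSpace ℝ E]
    {G : E → E →L[ℝ] E →L[ℝ] ℝ} {Ω Ω₁ : Set E} (h : IsMetricOn G Ω) (hΩ₁ : IsOpen Ω₁)
    (hsub : Ω₁ ⊆ Ω) : IsMetricOn G Ω₁ where
  isOpen := hΩ₁
  contDiffOn := h.contDiffOn.mono hsub
  symm y hy := h.symm y (hsub hy)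
  isInvertible y hy := h.isInvertible y (hsub hy)

lemma isInvertible_of_injective {E : Type*} [NormedAddCommGroup E] [NormedSpace ℝ E]
    [FiniteDimensional ℝ E] {B : E →L[ℝ] E →L[ℝ] ℝ} (hB : Function.Injective B) :
    B.IsInvertible := by
  have hdim : Module.finrank ℝ E = Module.finrank ℝ (E →L[ℝ] ℝ) := by
    rw [← (LinearMap.toContinuousLinearMap (𝕜 := ℝ) (E := E) (F' := ℝ)).finrank_eq]
    exact (Subspace.dual_finrank_eq).symm
  exact ⟨(LinearEquiv.ofBijective (B : E →ₗ[ℝ] E →L[ℝ] ℝ)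
    ⟨hB, (LinearMap.injective_iff_surjective_of_finrank_eq_finrank hdim).mp
      hB⟩).toContinuousLinearEquiv, by ext; rfl⟩

/-- By Sylvester's law the radical has dimension `n - p - q = 0`. -/
lemma PseudoRiemannianMetric.eq_zero_of_form_eq_zero {p q : ℕ} (hpq : p + q = n)
    (g : PseudoRiemannianMetric n M p q) (z : M) (u : TangentSpace (𝓡 n) z)
    (hu : ∀ v, g.form z u v = 0) : u = 0 := by
  have : FiniteDimensional ℝ (TangentSpace (𝓡 n) z) :=
    inferInstanceAs (FiniteDimensional ℝ (EuclideanSpace ℝ (Fin n)))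
  have hdim : Module.finrank ℝ (TangentSpace (𝓡 n) z) = n :=
    (finrank_euclideanSpace_fin (𝕜 := ℝ) (n := n))
  have h1 := QuadraticForm.sigPos_add_sigNeg_add_radical
    (Q := (g.form z).toBilinForm.toQuadraticMap)
  rw [g.sigNeg_eq, g.sigPos_eq, hdim] at h1
  have h2 : Module.finrank ℝ (g.form z).toBilinForm.toQuadraticMap.radical = 0 := by omega
  rw [Submodule.finrank_eq_zero] at h2
  have h3 : u ∈ (g.form z).toBilinForm.toQuadraticMap.radical := by
    rw [QuadraticMap.mem_radical_iff']
    have key : ∀ w, (g.form z).toBilinForm.toQuadraticMap w = g.form z w w := fun w ↦ rfl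
    refine ⟨by rw [key, hu], fun v ↦ ?_⟩
    rw [key, key, map_add, map_add, add_apply, add_apply, hu, hu, g.symm z v u, hu]
    simp
  rw [h2] at h3
  simpa using h3

lemma isMetricOn_coordForm {p q : ℕ} (hpq : p + q = n) (g : PseudoRiemannianMetric n M p q)
    (x₀ : M) : IsMetricOn (coordForm g.form x₀) (extChartAt (𝓡 n) x₀).target where
  isOpen := isOpen_extChartAt_target x₀
  contDiffOn := contDiffOn_coordForm g.contMDiff x₀
  symm y _ u v := by rw [coordForm_apply, coordForm_apply, g.symm]
  isInvertible y hy := by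
    have hz := (extChartAt (𝓡 n) x₀).map_target hy
    refine isInvertible_of_injective ((injective_iff_map_eq_zero _).mpr fun u hu ↦ ?_)
    have h1 : coordFrame x₀ ((extChartAt (𝓡 n) x₀).symm y) u = 0 := by
      refine g.eq_zero_of_form_eq_zero hpq _ _ fun v ↦ ?_
      rw [← coordFrame_coordCoframe hz v, ← coordForm_apply, hu]
      rfl
    rw [← coordCoframe_coordFrame hz u, h1, map_zero]

/-- The coordinate frame and coframe are the derivatives of the inverse chart and of the chart, so
this is the chain rule. -/
lemma fderiv_localRep {y₀ x₀ : M} {f : M → M} (hf : ContMDiff (𝓡 n) (𝓡 n) ∞ f)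
    {p : EuclideanSpace ℝ (Fin n)} (hp : p ∈ localDomain y₀ x₀ f)
    (u : EuclideanSpace ℝ (Fin n)) :
    fderiv ℝ (localRep y₀ x₀ f) p u =
      coordCoframe x₀ (f ((extChartAt (𝓡 n) y₀).symm p))
        (mfderiv (𝓡 n) (𝓡 n) f ((extChartAt (𝓡 n) y₀).symm p)
          (coordFrame y₀ ((extChartAt (𝓡 n) y₀).symm p) u)) := by
  set z := (extChartAt (𝓡 n) y₀).symm p with hz
  have hzs : z ∈ (extChartAt (𝓡 n) y₀).source := (extChartAt (𝓡 n) y₀).map_target hp.1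
  have hpz : extChartAt (𝓡 n) y₀ z = p := (extChartAt (𝓡 n) y₀).right_inv hp.1
  have hfz : f z ∈ (extChartAt (𝓡 n) x₀).source := hp.2
  have h1 : HasMFDerivAt 𝓘(ℝ, EuclideanSpace ℝ (Fin n)) (𝓡 n) (extChartAt (𝓡 n) y₀).symm p
      (coordFrame y₀ z) := by
    have h2 := (mdifferentiableWithinAt_extChartAt_symm (I := 𝓡 n) hp.1).hasMFDerivWithinAt
    have e1 := TangentBundle.symmL_trivializationAt (𝕜 := ℝ) (I := 𝓡 n) (x₀ := y₀) (x := z)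
      (by simpa using hzs)
    rw [hpz] at e1
    have e2 : coordFrame y₀ z = mfderivWithin 𝓘(ℝ, EuclideanSpace ℝ (Fin n)) (𝓡 n)
      (extChartAt (𝓡 n) y₀).symm (Set.range (𝓡 n)) p := e1
    rw [e2]
    rw [ModelWithCorners.range_eq_univ] at h2 ⊢
    exact hasMFDerivWithinAt_univ.mp h2
  have h2 : HasMFDerivAt (𝓡 n) 𝓘(ℝ, EuclideanSpace ℝ (Fin n)) (extChartAt (𝓡 n) x₀) (f z)
      (coordCoframe x₀ (f z)) := by
    have h3 := (mdifferentiableAt_extChartAt (I := 𝓡 n) (x := x₀) (y := f z)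
      (by simpa using hfz)).hasMFDerivAt
    have e1 := TangentBundle.continuousLinearMapAt_trivializationAt (𝕜 := ℝ) (I := 𝓡 n)
      (x₀ := x₀) (x := f z) (by simpa using hfz)
    have e2 : coordCoframe x₀ (f z) = mfderiv (𝓡 n) 𝓘(ℝ, EuclideanSpace ℝ (Fin n))
      (extChartAt (𝓡 n) x₀) (f z) := e1
    rw [e2]
    exact h3
  have h3 : HasMFDerivAt (𝓡 n) (𝓡 n) f z (mfderiv (𝓡 n) (𝓡 n) f z) :=
    (hf.mdifferentiableAt (by simp)).hasMFDerivAt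
  let L : EuclideanSpace ℝ (Fin n) →L[ℝ] EuclideanSpace ℝ (Fin n) :=
    coordCoframe x₀ (f z) ∘L mfderiv (𝓡 n) (𝓡 n) f z ∘L coordFrame y₀ z
  have h4 : HasFDerivAt (localRep y₀ x₀ f) L p := (h2.comp p (h3.comp p h1)).hasFDerivAt
  rw [h4.fderiv]
  rfl

lemma isConformalOn_localRep {p q : ℕ} (hpq : p + q = n) (g : PseudoRiemannianMetric n M p q)
    {f : M ≃ₘ⟮𝓡 n, 𝓡 n⟯ M} {φ : M → ℝ} (hφ : ContMDiff (𝓡 n) 𝓘(ℝ, ℝ) ∞ φ) (hpos : ∀ y, 0 < φ y)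
    (hconf : ∀ (y : M) (u v : TangentSpace (𝓡 n) y),
      g.form (f y) (mfderiv (𝓡 n) (𝓡 n) f y u) (mfderiv (𝓡 n) (𝓡 n) f y v) =
        φ y * g.form y u v) (y₀ x₀ : M) :
    IsConformalOn (coordForm g.form y₀) (coordForm g.form x₀) (localDomain y₀ x₀ f)
      (extChartAt (𝓡 n) x₀).target (localRep y₀ x₀ f)
      (fun w ↦ Real.log (φ ((extChartAt (𝓡 n) y₀).symm w)) / 2) where
  source := (isMetricOn_coordForm hpq g y₀).mono (isOpen_localDomain y₀ x₀ f.continuous)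
    Set.inter_subset_left
  target := isMetricOn_coordForm hpq g x₀
  contDiffOn := by
    refine contMDiffOn_iff_contDiffOn.mp ?_
    refine (contMDiffOn_extChartAt (x := x₀)).comp ((f.contMDiff.comp_contMDiffOn
      ((contMDiffOn_extChartAt_symm y₀).mono Set.inter_subset_left))) fun w hw ↦ ?_
    simpa using hw.2
  mapsTo w hw := (extChartAt (𝓡 n) x₀).map_source hw.2
  contDiffOn_factor := by
    have : ContDiffOn ℝ ∞ (φ ∘ (extChartAt (𝓡 n) y₀).symm) (localDomain y₀ x₀ f) :=
      contMDiffOn_iff_contDiffOn.mp (hφ.comp_contMDiffOn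
        ((contMDiffOn_extChartAt_symm y₀).mono Set.inter_subset_left))
    exact (this.log fun w _ ↦ (hpos _).ne').div_const 2
  conformal w hw u v := by
    have hfs : f ((extChartAt (𝓡 n) y₀).symm w) ∈ (extChartAt (𝓡 n) x₀).source := hw.2
    have hinv : (extChartAt (𝓡 n) x₀).symm (localRep y₀ x₀ f w) =
        f ((extChartAt (𝓡 n) y₀).symm w) := (extChartAt (𝓡 n) x₀).left_inv hw.2
    rw [fderiv_localRep f.contMDiff hw, fderiv_localRep f.contMDiff hw, coordForm_apply,
      coordForm_apply, hinv, coordFrame_coordCoframe hfs, coordFrame_coordCoframe hfs, hconf,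
      mul_div_cancel₀ _ two_ne_zero, Real.exp_log (hpos _)]

end Charts

/-! ### Comparison of norms and Jacobians with coordinate quantities. -/

section Regularity

/-- A continuous field of positive definite forms is uniformly positive definite on compact
sets. -/
lemma exists_pos_mul_norm_sq_le {E : Type*} [NormedAddCommGroup E] [NormedSpace ℝ E]
    [FiniteDimensional ℝ E] {H : E → E →L[ℝ] E →L[ℝ] ℝ} {K : Set E} (hK : IsCompact K)
    (hH : ContinuousOn H K) (hpos : ∀ p ∈ K, ∀ w ≠ 0, 0 < H p w w) :
    ∃ m > 0, ∀ p ∈ K, ∀ w, m * ‖w‖ ^ 2 ≤ H p w w := by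
  have : ProperSpace E := FiniteDimensional.proper ℝ E
  rcases (K ×ˢ Metric.sphere (0 : E) 1).eq_empty_or_nonempty with hempty | hne
  · refine ⟨1, one_pos, fun p hp w ↦ ?_⟩
    rcases eq_or_ne w 0 with rfl | hw
    · simp
    have hw0 : 0 < ‖w‖ := norm_pos_iff.mpr hw
    have : (p, ‖w‖⁻¹ • w) ∈ K ×ˢ Metric.sphere (0 : E) 1 :=
      Set.mk_mem_prod hp (by simp [norm_smul, hw0.ne'])
    rw [hempty] at this
    exact this.elim
  have hcont : ContinuousOn (fun t : E × E ↦ H t.1 t.2 t.2) (K ×ˢ Metric.sphere 0 1) :=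
    ((hH.comp continuousOn_fst fun t ht ↦ ht.1).clm_apply continuousOn_snd).clm_apply
      continuousOn_snd
  obtain ⟨t₀, ht₀, hmin⟩ := (hK.prod (isCompact_sphere _ _)).exists_isMinOn hne hcont
  refine ⟨H t₀.1 t₀.2 t₀.2, hpos _ ht₀.1 _ ?_, fun p hp w ↦ ?_⟩
  · rintro h0
    have := ht₀.2
    rw [h0] at this
    simp at this
  rcases eq_or_ne w 0 with rfl | hw
  · simp
  have hw0 : 0 < ‖w‖ := norm_pos_iff.mpr hw
  have hmem : (p, ‖w‖⁻¹ • w) ∈ K ×ˢ Metric.sphere (0 : E) 1 :=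
    Set.mk_mem_prod hp (by simp [norm_smul, hw0.ne'])
  have h1 : H t₀.1 t₀.2 t₀.2 ≤ H p (‖w‖⁻¹ • w) (‖w‖⁻¹ • w) := hmin hmem
  simp only [map_smul, smul_apply, smul_eq_mul] at h1
  calc H t₀.1 t₀.2 t₀.2 * ‖w‖ ^ 2 ≤ (‖w‖⁻¹ * (‖w‖⁻¹ * H p w w)) * ‖w‖ ^ 2 := by gcongr
    _ = _ := by field_simp

variable {n : ℕ} {M : Type*} [TopologicalSpace M]
  [ChartedSpace (EuclideanSpace ℝ (Fin n)) M] [IsManifold (𝓡 n) ∞ M]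

lemma exists_riemannianNorm_comparable
    (h : ContMDiffRiemannianMetric (𝓡 n) ∞ (EuclideanSpace ℝ (Fin n))
      (fun y : M ↦ TangentSpace (𝓡 n) y)) (x₀ : M) {K : Set (EuclideanSpace ℝ (Fin n))}
    (hK : IsCompact K) (hKt : K ⊆ (extChartAt (𝓡 n) x₀).target) :
    ∃ A : ℝ, 1 ≤ A ∧ ∀ p ∈ K, ∀ w : EuclideanSpace ℝ (Fin n),
      riemannianNorm h ((extChartAt (𝓡 n) x₀).symm p)
        (coordFrame x₀ ((extChartAt (𝓡 n) x₀).symm p) w) ≤ A * ‖w‖ ∧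
      ‖w‖ ≤ A * riemannianNorm h ((extChartAt (𝓡 n) x₀).symm p)
        (coordFrame x₀ ((extChartAt (𝓡 n) x₀).symm p) w) := by
  set H := coordForm h.inner x₀ with hH
  have hHc : ContinuousOn H K := (contDiffOn_coordForm h.contMDiff x₀).continuousOn.mono hKt
  obtain ⟨C, hC⟩ := hK.exists_bound_of_continuousOn hHc
  have hpos : ∀ p ∈ K, ∀ w ≠ 0, 0 < H p w w := by
    intro p hp w hw
    rw [hH, coordForm_apply]
    refine h.pos _ _ fun h0 ↦ hw ?_
    rw [← coordCoframe_coordFrame ((extChartAt (𝓡 n) x₀).map_target (hKt hp)) w, h0, map_zero]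
  obtain ⟨m, hm0, hlow⟩ := exists_pos_mul_norm_sq_le hK hHc hpos
  -- Taking `A ≥ 1` allows `A ≤ A²`, which absorbs the square root in the norm.
  refine ⟨1 + |C| + 1 / m, by have : 0 < 1 / m := by positivity
                              linarith [abs_nonneg C], fun p hp w ↦ ?_⟩
  have hnorm : riemannianNorm h ((extChartAt (𝓡 n) x₀).symm p)
        (coordFrame x₀ ((extChartAt (𝓡 n) x₀).symm p) w) = √(H p w w) := rfl
  rw [hnorm]
  have hm1 : 0 < 1 / m := by positivity
  have hCn := abs_nonneg C
  set A := 1 + |C| + 1 / m with hA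
  have hA1 : 1 ≤ A := by linarith
  constructor
  · apply Real.sqrt_le_iff.mpr ⟨by positivity, ?_⟩
    have h1 : H p w w ≤ C * ‖w‖ * ‖w‖ := by
      refine (le_abs_self _).trans ((norm_apply₂_le (H p) w w).trans ?_)
      gcongr
      exact hC p hp
    calc H p w w ≤ C * ‖w‖ * ‖w‖ := h1
      _ ≤ A * ‖w‖ * ‖w‖ := by gcongr; linarith [le_abs_self C]
      _ ≤ A * A * (‖w‖ * ‖w‖) := by
          rw [mul_assoc]; gcongr; nlinarith
      _ = _ := by ring
  · have h1 : ‖w‖ ^ 2 ≤ A ^ 2 * H p w w := by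
      have h2 := hlow p hp w
      have h3 : ‖w‖ ^ 2 ≤ 1 / m * H p w w := by
        rw [one_div_mul_eq_div, le_div_iff₀ hm0]; linarith
      have h4 : 0 ≤ H p w w := le_trans (by positivity) h2
      refine h3.trans ?_
      gcongr
      nlinarith
    rw [← Real.sqrt_sq (norm_nonneg w), ← Real.sqrt_sq (by positivity : 0 ≤ A),
      ← Real.sqrt_mul (by positivity)]
    exact Real.sqrt_le_sqrt h1

/-- The matrix of the frame field in the coordinate frame at `x₀`. -/
def coordFrameField (σ : BoundedFrameField n M) (x₀ z : M) :
    EuclideanSpace ℝ (Fin n) →L[ℝ] EuclideanSpace ℝ (Fin n) :=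
  coordCoframe x₀ z ∘L (σ.frame z : EuclideanSpace ℝ (Fin n) →L[ℝ] TangentSpace (𝓡 n) z)

lemma det_ne_zero_of_injective {L : EuclideanSpace ℝ (Fin n) →L[ℝ] EuclideanSpace ℝ (Fin n)}
    (hL : Function.Injective L) : L.det ≠ 0 :=
  ((LinearMap.isUnit_iff_isUnit_det _).mp
    ((LinearMap.isUnit_iff_ker_eq_bot _).mpr (LinearMap.ker_eq_bot.mpr hL))).ne_zero

lemma injective_coordCoframe {x₀ z : M} (hz : z ∈ (extChartAt (𝓡 n) x₀).source) :
    Function.Injective (coordCoframe (n := n) x₀ z) :=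
  Function.LeftInverse.injective (coordFrame_coordCoframe hz)

/-- The frames of the given compact set that lie over the image of `K` form a compact set, on which
the coordinate determinant is continuous and nonzero. -/
lemma exists_det_frame_comparable [T2Space M] (σ : BoundedFrameField n M) (x₀ : M)
    {K : Set (EuclideanSpace ℝ (Fin n))}
    (hK : IsCompact K) (hKt : K ⊆ (extChartAt (𝓡 n) x₀).target) :
    ∃ A : ℝ, 1 ≤ A ∧ ∀ p ∈ K,
      |(coordFrameField σ x₀ ((extChartAt (𝓡 n) x₀).symm p)).det| ≤ A ∧
      1 ≤ A * |(coordFrameField σ x₀ ((extChartAt (𝓡 n) x₀).symm p)).det| := by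
  obtain ⟨Q, hQ, hQbij, hσ⟩ := σ.bounded
  set N := (extChartAt (𝓡 n) x₀).symm '' K with hN
  have hNc : IsCompact N := hK.image_of_continuousOn ((continuousOn_extChartAt_symm x₀).mono hKt)
  have hNs : N ⊆ (extChartAt (𝓡 n) x₀).source := by
    rintro _ ⟨p, hp, rfl⟩
    exact (extChartAt (𝓡 n) x₀).map_target (hKt hp)
  set Q' := Q ∩ (TotalSpace.proj ⁻¹' N) with hQ'
  have hproj : Continuous (TotalSpace.proj : HomFrames n M → M) :=
    FiberBundle.continuous_proj _ _
  have hQ'c : IsCompact Q' := hQ.inter_right (hNc.isClosed.preimage hproj)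
  set D : HomFrames n M → ℝ := fun u ↦
    ContinuousLinearMap.det (coordCoframe x₀ u.1 ∘L u.2 :
      EuclideanSpace ℝ (Fin n) →L[ℝ] EuclideanSpace ℝ (Fin n)) with hD
  have hDc : ContinuousOn D Q' := by
    set e := trivializationAt (EuclideanSpace ℝ (Fin n) →L[ℝ] EuclideanSpace ℝ (Fin n))
      (fun y : M ↦ Bundle.Trivial M (EuclideanSpace ℝ (Fin n)) y →L[ℝ] TangentSpace (𝓡 n) y) x₀
      with he
    have hsub : Q' ⊆ e.source := fun u hu ↦ by
      have := hNs hu.2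
      rw [e.mem_source, he, hom_trivializationAt_baseSet]
      simpa using this
    have h1 : ContinuousOn (fun u ↦ (e u).2) Q' :=
      continuous_snd.comp_continuousOn (e.continuousOn.mono hsub)
    have h2 : ContinuousOn (fun u ↦ ContinuousLinearMap.det (e u).2) Q' :=
      ContinuousLinearMap.continuous_det.comp_continuousOn h1
    refine h2.congr fun u hu ↦ ?_
    change D u = ContinuousLinearMap.det (ContinuousLinearMap.inCoordinates
      (EuclideanSpace ℝ (Fin n)) (Bundle.Trivial M (EuclideanSpace ℝ (Fin n)))
      (EuclideanSpace ℝ (Fin n)) (TangentSpace (𝓡 n)) x₀ u.1 x₀ u.1 u.2)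
    have h3 : ContinuousLinearMap.inCoordinates
        (EuclideanSpace ℝ (Fin n)) (Bundle.Trivial M (EuclideanSpace ℝ (Fin n)))
        (EuclideanSpace ℝ (Fin n)) (TangentSpace (𝓡 n)) x₀ u.1 x₀ u.1 u.2 =
        (coordCoframe x₀ u.1 ∘L u.2 :
          EuclideanSpace ℝ (Fin n) →L[ℝ] EuclideanSpace ℝ (Fin n)) := by
      ext1 v
      simp [ContinuousLinearMap.inCoordinates, coordCoframe]
    exact congrArg ContinuousLinearMap.det h3.symm
  have hD0 : ∀ u ∈ Q', D u ≠ 0 := fun u hu ↦ det_ne_zero_of_injective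
    ((injective_coordCoframe (hNs hu.2)).comp (hQbij u hu.1).injective)
  obtain ⟨C₁, hC₁⟩ := hQ'c.exists_bound_of_continuousOn hDc
  obtain ⟨C₂, hC₂⟩ := hQ'c.exists_bound_of_continuousOn (f := fun u ↦ (D u)⁻¹) (hDc.inv₀ hD0)
  refine ⟨1 + |C₁| + |C₂|, by linarith [abs_nonneg C₁, abs_nonneg C₂], fun p hp ↦ ?_⟩
  set z := (extChartAt (𝓡 n) x₀).symm p with hz
  set u : HomFrames n M := ⟨z, (σ.frame z : EuclideanSpace ℝ (Fin n) →L[ℝ] TangentSpace (𝓡 n) z)⟩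
    with hu
  have huQ : u ∈ Q' := ⟨hσ z, Set.mem_image_of_mem _ hp⟩
  have hDu : (coordFrameField σ x₀ z).det = D u := rfl
  rw [hDu]
  have hD1 : 0 < |D u| := abs_pos.mpr (hD0 u huQ)
  constructor
  · exact (hC₁ u huQ).trans (by linarith [le_abs_self C₁, abs_nonneg C₂])
  · have h1 := hC₂ u huQ
    rw [Real.norm_eq_abs, abs_inv, inv_le_iff_one_le_mul₀ hD1] at h1
    refine h1.trans ?_
    gcongr
    linarith [le_abs_self C₂, abs_nonneg C₁]

/-- The two derivatives differ by changes of frame at the source and at the target. The product form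
avoids inverting either of them. -/
lemma det_jacobian_mul (σ : BoundedFrameField n M) (f : M ≃ₘ⟮𝓡 n, 𝓡 n⟯ M) {y₀ x₀ : M}
    {p : EuclideanSpace ℝ (Fin n)} (hp : p ∈ localDomain y₀ x₀ f) :
    (coordFrameField σ x₀ (f ((extChartAt (𝓡 n) y₀).symm p))).det *
        (jacobian σ f ((extChartAt (𝓡 n) y₀).symm p)).det =
      (fderiv ℝ (localRep y₀ x₀ f) p).det *
        (coordFrameField σ y₀ ((extChartAt (𝓡 n) y₀).symm p)).det := by
  set z := (extChartAt (𝓡 n) y₀).symm p with hz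
  have hzs : z ∈ (extChartAt (𝓡 n) y₀).source := (extChartAt (𝓡 n) y₀).map_target hp.1
  have key : coordFrameField σ x₀ (f z) ∘L jacobian σ f z =
      fderiv ℝ (localRep y₀ x₀ f) p ∘L coordFrameField σ y₀ z := by
    ext1 u
    rw [ContinuousLinearMap.comp_apply, ContinuousLinearMap.comp_apply,
      fderiv_localRep f.contMDiff hp]
    have h1 : coordFrame y₀ z (coordFrameField σ y₀ z u) = σ.frame z u :=
      coordFrame_coordCoframe hzs _
    rw [← hz, h1]
    have h2 : σ.frame (f z) (jacobian σ f z u) = mfderiv (𝓡 n) (𝓡 n) f z (σ.frame z u) :=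
      (σ.frame (f z)).apply_symm_apply _
    rw [← h2]
    rfl
  have := congrArg ContinuousLinearMap.det key
  simp only [ContinuousLinearMap.det] at this ⊢
  rw [← LinearMap.det_comp, ← LinearMap.det_comp]
  exact this

end Regularity

/-! ### Propagation of Lyapunov regularity. -/

section Propagation

variable {n : ℕ} {M : Type*} [TopologicalSpace M]
  [ChartedSpace (EuclideanSpace ℝ (Fin n)) M]

/-- The compact sets contained in a given open neighborhood of `x` form an open neighborhood of
`{x}`. -/
lemma CollapsesTo.eventually_mapsTo [CompactSpace M] {f : ℕ → M ≃ₘ⟮𝓡 n, 𝓡 n⟯ M} {V : Set M}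
    {x : M} (hV : CollapsesTo f V x) {N : Set M} (hN : N ∈ 𝓝 x) :
    ∀ᶠ k in atTop, Set.MapsTo (f k) V N := by
  obtain ⟨O, hON, hO, hxO⟩ := mem_nhds_iff.mp hN
  have hmem : {K : Compacts M | (K : Set M) ⊆ O} ∈ 𝓝 ({x} : Compacts M) :=
    (Compacts.isOpen_subsets_of_isOpen hO).mem_nhds (by simpa using hxO)
  filter_upwards [hV hmem] with k hk y hy
  exact hON (hk (Set.mem_image_of_mem _ (subset_closure hy)))

variable [IsManifold (𝓡 n) ∞ M]

/-- Lyapunov regularity can be read in charts, as long as the images stay in a compact part of the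
target chart. -/
lemma isUniformlyLyapunovRegularAt_iff [T2Space M]
    (h : ContMDiffRiemannianMetric (𝓡 n) ∞ (EuclideanSpace ℝ (Fin n))
      (fun y : M ↦ TangentSpace (𝓡 n) y))
    (σ : BoundedFrameField n M) {T : ℕ → ℝ} (hT : Tendsto T atTop atTop)
    (f : ℕ → M ≃ₘ⟮𝓡 n, 𝓡 n⟯ M) (χ : ℝ) {y₀ x a : M} {K : Set (EuclideanSpace ℝ (Fin n))}
    (hK : IsCompact K) (hKt : K ⊆ (extChartAt (𝓡 n) x).target)
    (ha : a ∈ (extChartAt (𝓡 n) y₀).source)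
    (hfa : ∀ᶠ k in atTop, f k a ∈ (extChartAt (𝓡 n) x).source ∧ extChartAt (𝓡 n) x (f k a) ∈ K)
    (hinj : ∀ᶠ k in atTop, Function.Injective
      (fderiv ℝ (localRep y₀ x (f k)) (extChartAt (𝓡 n) y₀ a))) :
    IsUniformlyLyapunovRegularAt h σ T f χ a ↔
      (∀ w ≠ 0, HasRate T
        (fun k ↦ ‖fderiv ℝ (localRep y₀ x (f k)) (extChartAt (𝓡 n) y₀ a) w‖) χ) ∧
      HasRate T (fun k ↦ |(fderiv ℝ (localRep y₀ x (f k)) (extChartAt (𝓡 n) y₀ a)).det|)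
        (n * χ) := by
  set p := extChartAt (𝓡 n) y₀ a with hp
  have hpa : (extChartAt (𝓡 n) y₀).symm p = a := (extChartAt (𝓡 n) y₀).left_inv ha
  have hdom : ∀ᶠ k in atTop, p ∈ localDomain y₀ x (f k) := by
    filter_upwards [hfa] with k hk
    refine ⟨(extChartAt (𝓡 n) y₀).map_source ha, ?_⟩
    simpa only [Set.mem_preimage, hpa] using hk.1
  obtain ⟨A, hA1, hA⟩ := exists_riemannianNorm_comparable h x hK hKt
  obtain ⟨B, hB1, hB⟩ := exists_det_frame_comparable σ x hK hKt
  have hnorm : ∀ᶠ k in atTop, ∀ w : EuclideanSpace ℝ (Fin n),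
      riemannianNorm h (f k a) (mfderiv (𝓡 n) (𝓡 n) (f k) a (coordFrame y₀ a w)) ≤
        A * ‖fderiv ℝ (localRep y₀ x (f k)) p w‖ ∧
      ‖fderiv ℝ (localRep y₀ x (f k)) p w‖ ≤
        A * riemannianNorm h (f k a) (mfderiv (𝓡 n) (𝓡 n) (f k) a (coordFrame y₀ a w)) := by
    filter_upwards [hfa, hdom] with k hk hkd w
    have h1 := hA _ hk.2 (fderiv ℝ (localRep y₀ x (f k)) p w)
    rw [(extChartAt (𝓡 n) x).left_inv hk.1, fderiv_localRep (f k).contMDiff hkd, hpa,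
      coordFrame_coordCoframe hk.1] at h1
    rwa [fderiv_localRep (f k).contMDiff hkd, hpa]
  have hc : 0 < |(coordFrameField σ y₀ a).det| :=
    abs_pos.mpr (det_ne_zero_of_injective
      ((injective_coordCoframe ha).comp (σ.frame a).injective))
  set c := |(coordFrameField σ y₀ a).det| with hcdef
  -- The source determinant `c` does not depend on `k`. Both `c` and `c⁻¹` occur, one for each
  -- direction of the comparison.
  set C := B * (c + c⁻¹ + 1) with hC
  have hc' : 0 < c⁻¹ := inv_pos.mpr hc
  have hC1 : 1 ≤ C := one_le_mul_of_one_le_of_one_le hB1 (by linarith)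
  have hdet : ∀ᶠ k in atTop,
      |(jacobian σ (f k) a).det| ≤ C * |(fderiv ℝ (localRep y₀ x (f k)) p).det| ∧
      |(fderiv ℝ (localRep y₀ x (f k)) p).det| ≤ C * |(jacobian σ (f k) a).det| := by
    filter_upwards [hfa, hdom] with k hk hkd
    have h1 := hB _ hk.2
    rw [(extChartAt (𝓡 n) x).left_inv hk.1] at h1
    have h2 := congrArg abs (det_jacobian_mul σ (f k) hkd)
    rw [hpa, abs_mul, abs_mul, ← hcdef] at h2
    set s := |(coordFrameField σ x (f k a)).det|
    set j := |(jacobian σ (f k) a).det|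
    set d := |(fderiv ℝ (localRep y₀ x (f k)) p).det|
    have hj : 0 ≤ j := abs_nonneg _
    have hd : 0 ≤ d := abs_nonneg _
    constructor
    · calc j = 1 * j := (one_mul j).symm
        _ ≤ B * s * j := by gcongr; exact h1.2
        _ = B * c * d := by rw [mul_assoc, h2]; ring
        _ ≤ C * d := by rw [hC]; gcongr; linarith
    · calc d = c⁻¹ * (d * c) := by field_simp
        _ = c⁻¹ * (s * j) := by rw [h2]
        _ ≤ c⁻¹ * (B * j) := by gcongr; exact h1.1
        _ = B * c⁻¹ * j := by ring
        _ ≤ C * j := by rw [hC]; gcongr; linarith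
  have hFpos : ∀ w ≠ 0, ∀ᶠ k in atTop, 0 < ‖fderiv ℝ (localRep y₀ x (f k)) p w‖ := by
    intro w hw
    filter_upwards [hinj] with k hk
    exact norm_pos_iff.mpr fun h0 ↦ hw (hk (by rw [h0, map_zero]))
  have hDpos : ∀ᶠ k in atTop, 0 < |(fderiv ℝ (localRep y₀ x (f k)) p).det| := by
    filter_upwards [hinj] with k hk using abs_pos.mpr (det_ne_zero_of_injective hk)
  constructor
  · rintro ⟨hn, hd⟩
    refine ⟨fun w hw ↦ ?_, ?_⟩
    · have hv : coordFrame y₀ a w ≠ 0 := fun h0 ↦ hw (by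
        rw [← coordCoframe_coordFrame ha w, h0, map_zero])
      refine HasRate.of_comparable hT hA1 (hn _ hv) ?_ (hnorm.mono fun k hk ↦ (hk w).2)
        (hnorm.mono fun k hk ↦ (hk w).1)
      filter_upwards [hnorm, hFpos w hw] with k hk hk'
      exact pos_of_mul_pos_right (hk'.trans_le (hk w).2) (by linarith)
    · refine HasRate.of_comparable hT hC1 hd ?_ (hdet.mono fun k hk ↦ hk.2)
        (hdet.mono fun k hk ↦ hk.1)
      filter_upwards [hdet, hDpos] with k hk hk'
      exact pos_of_mul_pos_right (hk'.trans_le hk.2) (by linarith)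
  · rintro ⟨hn, hd⟩
    refine ⟨fun v hv ↦ ?_, ?_⟩
    · have hw : coordCoframe y₀ a v ≠ 0 := fun h0 ↦ hv (by
        rw [← coordFrame_coordCoframe ha v, h0, map_zero])
      have := HasRate.of_comparable hT hA1 (hn _ hw) (hFpos _ hw)
        (hnorm.mono fun k hk ↦ (hk _).1) (hnorm.mono fun k hk ↦ (hk _).2)
      simp only [coordFrame_coordCoframe ha] at this
      exact this
    · exact HasRate.of_comparable hT hC1 hd hDpos (hdet.mono fun k hk ↦ hk.1)
        (hdet.mono fun k hk ↦ hk.2)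

/-- Rates of linear maps satisfying the estimates of `exists_harnack_bounds` coincide. -/
lemma hasRate_of_harnack {E : Type*} [NormedAddCommGroup E] [NormedSpace ℝ E]
    [FiniteDimensional ℝ E] [Nontrivial E] {T : ℕ → ℝ} (hT : Tendsto T atTop atTop) {χ A : ℝ}
    (hA : 1 ≤ A) {F F' : ℕ → E →L[ℝ] E} {ρ ρ' : ℕ → ℝ}
    (hinj : ∀ᶠ k in atTop, Function.Injective (F k))
    (hρ : ∀ᶠ k in atTop, ρ k ≤ ρ' k + A ∧ ρ' k ≤ ρ k + A)
    (hF : ∀ᶠ k in atTop, ‖F k‖ ≤ A * ‖F' k‖ ∧ ‖F' k‖ ≤ A * ‖F k‖)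
    (hdet : ∀ᶠ k in atTop, |(F k).det| ≤ A * Real.exp (Module.finrank ℝ E * ρ k) ∧
      Real.exp (Module.finrank ℝ E * ρ k) ≤ A * |(F k).det|)
    (hdet' : ∀ᶠ k in atTop, |(F' k).det| ≤ A * Real.exp (Module.finrank ℝ E * ρ' k) ∧
      Real.exp (Module.finrank ℝ E * ρ' k) ≤ A * |(F' k).det|)
    (hF' : ∀ᶠ k in atTop, ∀ v, Real.exp (2 * ρ' k) * ‖v‖ ≤ A * ‖F' k‖ * ‖F' k v‖)
    (hrate : ∀ v ≠ 0, HasRate T (fun k ↦ ‖F k v‖) χ)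
    (hrate_det : HasRate T (fun k ↦ |(F k).det|) (Module.finrank ℝ E * χ)) :
    (∀ v ≠ 0, HasRate T (fun k ↦ ‖F' k v‖) χ) ∧
      HasRate T (fun k ↦ |(F' k).det|) (Module.finrank ℝ E * χ) := by
  set d := Module.finrank ℝ E with hd
  have hd0 : d ≠ 0 := Module.finrank_pos.ne'
  -- The rate passes from `|det F|` to `e^{dρ}`, then to `e^{dρ'}` by Harnack, then to `ρ'` and to
  -- `|det F'|`.
  have hexp : HasRate T (fun k ↦ Real.exp (d * ρ k)) (d * χ) := by
    refine HasRate.of_comparable hT hA hrate_det ?_ (hdet.mono fun k hk ↦ hk.2)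
      (hdet.mono fun k hk ↦ hk.1)
    filter_upwards [hdet] with k hk
    exact pos_of_mul_pos_right ((Real.exp_pos _).trans_le hk.2) (by linarith)
  have hle : ∀ s t : ℝ, s ≤ t + A → Real.exp (d * s) ≤ Real.exp (d * A) * Real.exp (d * t) := by
    intro s t hst
    rw [← Real.exp_add]
    refine Real.exp_le_exp.mpr ?_
    rw [← mul_add]
    gcongr
    linarith
  have hexp' : HasRate T (fun k ↦ Real.exp (d * ρ' k)) (d * χ) :=
    HasRate.of_comparable hT (Real.one_le_exp (by positivity)) hexp
      (Eventually.of_forall fun k ↦ Real.exp_pos _) (hρ.mono fun k hk ↦ hle _ _ hk.2)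
      (hρ.mono fun k hk ↦ hle _ _ hk.1)
  have hρ' := (hasRate_exp_iff d hd0 ρ').mp hexp'
  have hop : HasRate T (fun k ↦ ‖F k‖) χ := hasRate_opNorm hT hinj hrate
  have hop' : HasRate T (fun k ↦ ‖F' k‖) χ := by
    refine HasRate.of_comparable hT hA hop ?_ (hF.mono fun k hk ↦ hk.2) (hF.mono fun k hk ↦ hk.1)
    filter_upwards [hinj] with k hk
    obtain ⟨v, hv⟩ := exists_ne (0 : E)
    exact norm_pos_iff.mpr fun h0 ↦ hv (hk (by rw [h0]; simp))
  exact ⟨fun v hv ↦ hasRate_norm_apply hT hA hF' hop' hρ' hv,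
    HasRate.of_comparable hT hA hexp' (Eventually.of_forall fun k ↦ Real.exp_pos _)
      (hdet'.mono fun k hk ↦ hk.1) (hdet'.mono fun k hk ↦ hk.2)⟩

/-- Lyapunov regularity of a collapsing sequence of conformal maps is locally constant. -/
lemma exists_nhds_isUniformlyLyapunovRegularAt [T2Space M] [CompactSpace M] {p q : ℕ}
    (hn : 3 ≤ n) (hpq : p + q = n) (g : PseudoRiemannianMetric n M p q)
    (h : ContMDiffRiemannianMetric (𝓡 n) ∞ (EuclideanSpace ℝ (Fin n))
      (fun y : M ↦ TangentSpace (𝓡 n) y))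
    (σ : BoundedFrameField n M) {T : ℕ → ℝ} (hT : Tendsto T atTop atTop) (χ : ℝ) {x y₀ : M}
    {f : ℕ → M ≃ₘ⟮𝓡 n, 𝓡 n⟯ M} (hf : ∀ k, IsConformal g (f k)) {V : Set M} (hV : V ∈ 𝓝 y₀)
    (hcol : CollapsesTo f V x) :
    ∃ W ∈ 𝓝 y₀, ∀ a ∈ W, ∀ b ∈ W, IsUniformlyLyapunovRegularAt h σ T f χ a →
      IsUniformlyLyapunovRegularAt h σ T f χ b := by
  have hfin : Module.finrank ℝ (EuclideanSpace ℝ (Fin n)) = n := finrank_euclideanSpace_fin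
  have : Nontrivial (EuclideanSpace ℝ (Fin n)) :=
    Module.nontrivial_of_finrank_pos (R := ℝ) (by omega)
  choose φ hφ hφpos hφconf using hf
  set c := extChartAt (𝓡 n) y₀ y₀ with hc
  have hnhds : (extChartAt (𝓡 n) y₀).target ∩ (extChartAt (𝓡 n) y₀).symm ⁻¹' V ∈ 𝓝 c := by
    refine inter_mem (extChartAt_target_mem_nhds y₀) ?_
    refine (continuousAt_extChartAt_symm y₀).preimage_mem_nhds ?_
    rwa [extChartAt_to_inv]
  obtain ⟨r, hr, hball⟩ := Metric.nhds_basis_closedBall.mem_iff.mp hnhds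
  obtain ⟨δ, hδ, hδt, A, hA, hH⟩ := exists_harnack_bounds (by rw [hfin]; exact hn)
    (isMetricOn_coordForm hpq g y₀) (isMetricOn_coordForm hpq g x) hr
    (fun w hw ↦ (hball hw).1) (mem_extChartAt_target x)
  -- Collapse eventually sends the source ball into this neighborhood, so the Harnack inequality
  -- applies to all large `k` with the same `A`.
  set N := (extChartAt (𝓡 n) x).source ∩
    extChartAt (𝓡 n) x ⁻¹' Metric.closedBall (extChartAt (𝓡 n) x x) δ with hN
  have hNx : N ∈ 𝓝 x := inter_mem (extChartAt_source_mem_nhds x)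
    ((continuousAt_extChartAt x).preimage_mem_nhds (Metric.closedBall_mem_nhds _ hδ))
  have hmaps := hcol.eventually_mapsTo hNx
  have hdom : ∀ᶠ k in atTop, Metric.closedBall c r ⊆ localDomain y₀ x (f k) :=
    hmaps.mono fun k hk w hw ↦ ⟨(hball hw).1, (hk (hball hw).2).1⟩
  have hmaps' : ∀ᶠ k in atTop, Set.MapsTo (localRep y₀ x (f k)) (Metric.closedBall c r)
      (Metric.closedBall (extChartAt (𝓡 n) x x) δ) :=
    hmaps.mono fun k hk w hw ↦ (hk (hball hw).2).2
  have hconf := fun k ↦ isConformalOn_localRep hpq g (hφ k) (hφpos k) (hφconf k) y₀ x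
  have hsub : Metric.closedBall c (r / 2) ⊆ Metric.closedBall c r :=
    Metric.closedBall_subset_closedBall (by linarith)
  have hiff : ∀ a ∈ (extChartAt (𝓡 n) y₀).source,
      extChartAt (𝓡 n) y₀ a ∈ Metric.closedBall c (r / 2) → _ := fun a ha hap ↦
    isUniformlyLyapunovRegularAt_iff h σ hT f χ (isCompact_closedBall _ _) hδt ha
      (hmaps.mono fun k hk ↦ hk (by
        simpa only [Set.mem_preimage, (extChartAt (𝓡 n) y₀).left_inv ha]
          using (hball (hsub hap)).2))
      (hdom.mono fun k hk ↦ (hconf k).injective_fderiv (hk (hsub hap)))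
  refine ⟨(extChartAt (𝓡 n) y₀).source ∩ extChartAt (𝓡 n) y₀ ⁻¹' Metric.closedBall c (r / 2),
    inter_mem (extChartAt_source_mem_nhds y₀)
      ((continuousAt_extChartAt y₀).preimage_mem_nhds
        (Metric.closedBall_mem_nhds _ (by positivity))), ?_⟩
  rintro a ⟨ha, hap⟩ b ⟨hb, hbp⟩ hreg
  obtain ⟨h1, h2⟩ := (hiff a ha hap).mp hreg
  have hest := (hdom.and hmaps').mono fun k hk ↦ hH _ _ _ hk.1 (hconf k) hk.2
  refine (hiff b hb hbp).mpr ?_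
  have hcast : (n : ℝ) = Module.finrank ℝ (EuclideanSpace ℝ (Fin n)) := by rw [hfin]
  rw [hcast] at h2 ⊢
  exact hasRate_of_harnack hT hA
    (hdom.mono fun k hk ↦ (hconf k).injective_fderiv (hk (hsub hap)))
    (hest.mono fun k hk ↦ ⟨((hk _ hap).1 _ hbp).1, ((hk _ hbp).1 _ hap).1⟩)
    (hest.mono fun k hk ↦ ⟨((hk _ hap).1 _ hbp).2, ((hk _ hbp).1 _ hap).2⟩)
    (hest.mono fun k hk ↦ (hk _ hap).2.2) (hest.mono fun k hk ↦ (hk _ hbp).2.2)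
    (hest.mono fun k hk ↦ (hk _ hbp).2.1) h1 h2

end Propagation

end ConformalDynamics

end

theorem mainTheorem5 {n p q : ℕ} (hn : 3 ≤ n) (hpq : p + q = n)
    {M : Type*} [TopologicalSpace M] [T2Space M] [CompactSpace M]
    [ChartedSpace (EuclideanSpace ℝ (Fin n)) M] [IsManifold (𝓡 n) ∞ M]
    (g : ConformalDynamics.PseudoRiemannianMetric n M p q)
    (h : ContMDiffRiemannianMetric (𝓡 n) ∞ (EuclideanSpace ℝ (Fin n))
      (fun y : M ↦ TangentSpace (𝓡 n) y))
    (σ : ConformalDynamics.BoundedFrameField n M)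
    (T : ℕ → ℝ) (hT_pos : ∀ k, 0 < T k) (hT : Tendsto T atTop atTop)
    (x : M) (U : Set M) (hU : U ∈ 𝓝 x) (hU_conn : IsConnected U)
    (f : ℕ → M ≃ₘ⟮𝓡 n, 𝓡 n⟯ M) (hf : ∀ k, ConformalDynamics.IsConformal g (f k))
    (hcollapse : ∀ y ∈ U, ∃ V ∈ 𝓝 y, ConformalDynamics.CollapsesTo f V x)
    (hreg : ∃ x₀ ∈ U, ConformalDynamics.IsUniformlyLyapunovRegularAt h σ T f (-1) x₀) :
    ∀ y ∈ U, ConformalDynamics.IsUniformlyLyapunovRegularAt h σ T f (-1) y := by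
  obtain ⟨x₀, hx₀, hreg₀⟩ := hreg
  intro y hy
  -- The relation "regular at `a` implies regular at `b`" is transitive and holds both ways between
  -- `z` and all nearby points, so it holds throughout the connected set `U`. Since `U` need not be
  -- open, neighborhoods are taken within `U`.
  refine hU_conn.isPreconnected.induction₂'
    (fun a b ↦ ConformalDynamics.IsUniformlyLyapunovRegularAt h σ T f (-1) a →
      ConformalDynamics.IsUniformlyLyapunovRegularAt h σ T f (-1) b)
    (fun z hz ↦ ?_) (fun _ _ _ _ _ _ hab hbc ha ↦ hbc (hab ha)) hx₀ hy hreg₀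
  obtain ⟨V, hV, hcol⟩ := hcollapse z hz
  obtain ⟨W, hW, hWreg⟩ := ConformalDynamics.exists_nhds_isUniformlyLyapunovRegularAt hn hpq g h σ
    hT (-1) hf hV hcol
  filter_upwards [mem_nhdsWithin_of_mem_nhds hW] with b hb
  exact ⟨hWreg z (mem_of_mem_nhds hW) b hb, hWreg b hb z (mem_of_mem_nhds hW)⟩
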